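/- For $t\in\mathbb C\setminus\{0,1\}$ and complex parameters $\epsilon_0,\epsilon_1,\epsilon_t,\alpha,\beta,q$ with $\epsilon_0+\epsilon_1+\epsilon_t=\alpha+\beta+1$, consider Heun's equation $$\frac{d^2y}{dz^2}+\left(\frac{\epsilon_0}{z}+\frac{\epsilon_1}{z-1}+\frac{\epsilon_t}{z-t}\right)\frac{dy}{dz}+\frac{\alpha\beta z-q}{z(z-1)(z-t)}\,y=0\qquad(\mathrm{E}).$$ Its exponents at $p\in\{0,1,t\}$ are $0$ and $1-\epsilon_p$, and at $\infty$ they are $\alpha$ and $\beta$. Let $\eta,\epsilon'_0,\epsilon'_1,\epsilon'_t,\alpha',\beta',q'\in\mathbb C$ satisfy $$(\eta-\alpha)(\eta-\beta)=0,\qquad \epsilon'_p=\epsilon_p-\eta+1\ (p=0,1,t),\qquad \{\alpha',\beta'\}=\{2-\eta,\ \alpha+\beta-2\eta+1\},$$ $$q'=q+(1-\eta)\bigl(\epsilon_t+\epsilon_1t+(\epsilon_0-\eta)(t+1)\bigr),$$ and let $(\mathrm{E}')$ be Heun's equation in the variable $w$ with the same $t$ and the parameters $\epsilon'_0,\epsilon'_1,\epsilon'_t,\alpha',\beta',q'$.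 (This is the relation between the parameters under which Euler's integral transformation with kernel $(z-w)^{-\eta}$ maps solutions of $(\mathrm{E}')$ to solutions of $(\mathrm{E})$.) A singularity $p$ is called non-logarithmic if its two exponents are distinct and for each exponent $\rho$ there is a solution $x^{\rho}u(x)$ without a logarithmic term, where $x=z-p$ (respectively $x=1/z$ if $p=\infty$), $u$ is holomorphic at $x=0$ and $u(0)=1$. Let $\{a,b,c\}=\{0,1,t\}$ with $a,b,c$ distinct. Then: (i) If $\epsilon'_a\in\mathbb Z_{\ge2}$, $\eta\notin\mathbb Z$ and the singularity $w=a$ of $(\mathrm{E}')$ is non-logarithmic, then $(\mathrm{E})$ has a non-zero solution $(z-a)^{1-\epsilon_a}h(z)$ with $h$ a polynomial of degree at most $\epsilon'_a-2$. If moreover $\alpha',\beta'\notin\mathbb Z$, then $\deg h=\epsilon'_a-2$. (ii) If $\epsilon'_a\in\mathbb Z_{\le0}$, $\eta,\alpha',\beta',\epsilon_b,\epsilon_c\notin\mathbb Z$ and the singularity $w=a$ of $(\mathrm{E}')$ is non-logarithmic, then $(\mathrm{E})$ has a non-zero solution $(z-b)^{1-\epsilon_b}(z-c)^{1-\epsilon_c}h(z)$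 with $h$ a polynomial of degree $-\epsilon'_a$. (iii) If $\epsilon_a\in\mathbb Z_{\ge2}$, $\alpha,\beta\notin\mathbb Z$ and $(\mathrm{E}')$ has a non-zero solution $(w-a)^{1-\epsilon'_a}h(w)$ with $h$ a polynomial, then the singularity $z=a$ of $(\mathrm{E})$ is non-logarithmic. (iv) If $\epsilon_a\in\mathbb Z_{\le0}$, $\alpha,\beta,\epsilon'_b,\epsilon'_c\notin\mathbb Z$ and $(\mathrm{E}')$ has a non-zero solution $(w-b)^{1-\epsilon'_b}(w-c)^{1-\epsilon'_c}h(w)$ with $h$ a polynomial, then the singularity $z=a$ of $(\mathrm{E})$ is non-logarithmic. (v) If $\alpha+\beta-\eta\in\mathbb Z_{\le0}$, $\eta\notin\mathbb Z$ and the singularity $w=\infty$ of $(\mathrm{E}')$ is non-logarithmic, then $(\mathrm{E})$ has a non-zero polynomial solution of degree $\eta-\alpha-\beta$. (vi) If $\alpha+\beta-\eta\in\mathbb Z_{\ge2}$, $\eta,\epsilon_0,\epsilon_1,\epsilon_t\notin\mathbb Z$ and the singularity $w=\infty$ of $(\mathrm{E}')$ is non-logarithmic, then $(\mathrm{E})$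 has a non-zero solution $z^{1-\epsilon_0}(z-1)^{1-\epsilon_1}(z-t)^{1-\epsilon_t}h(z)$ with $h$ a polynomial of degree $\alpha+\beta-\eta-2$. (vii) If $\alpha+\beta-2\eta\in\mathbb Z_{\le-1}$, $\eta,\epsilon'_0\notin\mathbb Z$ and $(\mathrm{E}')$ has a non-zero polynomial solution, then the singularity $z=\infty$ of $(\mathrm{E})$ is non-logarithmic. (viii) If $\alpha+\beta-2\eta\in\mathbb Z_{\ge1}$, $\eta,\epsilon'_0,\epsilon'_1,\epsilon'_t\notin\mathbb Z$ and $(\mathrm{E}')$ has a non-zero solution $w^{1-\epsilon'_0}(w-1)^{1-\epsilon'_1}(w-t)^{1-\epsilon'_t}h(w)$ with $h$ a polynomial, then the singularity $z=\infty$ of $(\mathrm{E})$ is non-logarithmic. -/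

import Mathlib

/-- The parameters of a Heun equation
`y'' + (ε₀/z + ε₁/(z-1) + ε_t/(z-t)) y' + (αβz - q)/(z(z-1)(z-t)) y = 0`.
The indices `0, 1, 2 : Fin 3` stand for the singularities `0, 1, t`. -/
structure Heun where
  t : ℂ
  ε : Fin 3 → ℂ
  α : ℂ
  β : ℂ
  q : ℂ

namespace Heun

/-- The finite singularities `0, 1, t`. -/
def sing (H : Heun) : Fin 3 → ℂ := ![0, 1, H.t]

/-- The plane without the finite singularities. -/
def regular (H : Heun) : Set ℂ := {0, 1, H.t}ᶜ

/-- The conditions on the parameters of a Heun equation: the four singularities are distinct, and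
`ε₀ + ε₁ + ε_t = α + β + 1`. -/
def IsAdmissible (H : Heun) : Prop :=
  H.t ≠ 0 ∧ H.t ≠ 1 ∧ H.ε 0 + H.ε 1 + H.ε 2 = H.α + H.β + 1

/-- `y` is a holomorphic solution on `U`; used for open `U ⊆ H.regular`. -/
def IsSolutionOn (H : Heun) (y : ℂ → ℂ) (U : Set ℂ) : Prop :=
  DifferentiableOn ℂ y U ∧ ∀ z ∈ U,
    deriv (deriv y) z
      + (H.ε 0 / z + H.ε 1 / (z - 1) + H.ε 2 / (z - H.t)) * deriv y z
      + (H.α * H.β * z - H.q) / (z * (z - 1) * (z - H.t)) * y z = 0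

/-- `L` is a holomorphic branch of `log (z - p)` on `U`. -/
def IsLogBranch (p : ℂ) (L : ℂ → ℂ) (U : Set ℂ) : Prop :=
  DifferentiableOn ℂ L U ∧ ∀ z ∈ U, Complex.exp (L z) = z - p

/-- The multivalued function `z ^ μ₀ (z - 1) ^ μ₁ (z - t) ^ μ_t h(z)` solves the equation: each of
its branches does, where a branch on an open set `U` is given by branches `L i` of the logarithms
of `z`, `z - 1`, `z - t` on `U`. (By analytic continuation, one branch on one non-empty open set
solves the equation if and only if all of them do.) -/
def IsPolyTypeSolution (H : Heun) (μ : Fin 3 → ℂ) (h : Polynomial ℂ) : Prop :=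
  ∀ (U : Set ℂ) (L : Fin 3 → ℂ → ℂ), IsOpen U → U ⊆ H.regular →
    (∀ i, IsLogBranch (H.sing i) (L i) U) →
    H.IsSolutionOn (fun z => (∏ i, Complex.exp (μ i * L i z)) * h.eval z) U

/-- The singularity `p = H.sing i`, whose exponents are `0` and `1 - ε i`, is non-logarithmic: the
exponents are distinct, and each exponent `ρ` has a solution `(z - p) ^ ρ * u z` without a
logarithmic term, where `u` is holomorphic about `p` with `u p = 1`. (For equal exponents there is
always a logarithmic solution.) -/
def NonLogarithmicAt (H : Heun) (i : Fin 3) : Prop :=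
  H.ε i ≠ 1 ∧ ∀ ρ ∈ ({0, 1 - H.ε i} : Set ℂ), ∃ r > (0 : ℝ), ∃ u : ℂ → ℂ,
    DifferentiableOn ℂ u (Metric.ball (H.sing i) r) ∧ u (H.sing i) = 1 ∧
    ∀ (U : Set ℂ) (L : ℂ → ℂ), IsOpen U → U ⊆ Metric.ball (H.sing i) r ∩ H.regular →
      IsLogBranch (H.sing i) L U →
      H.IsSolutionOn (fun z => Complex.exp (ρ * L z) * u z) U

/-- The singularity `∞`, whose exponents are `α` and `β`, is non-logarithmic: the exponents are
distinct, and each exponent `ρ` has a solution `(1 / z) ^ ρ * u (1 / z)` without a logarithmic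
term, where `u` is holomorphic about `0` with `u 0 = 1`. -/
def NonLogarithmicAtInfinity (H : Heun) : Prop :=
  H.α ≠ H.β ∧ ∀ ρ ∈ ({H.α, H.β} : Set ℂ), ∃ R > (0 : ℝ), ∃ u : ℂ → ℂ,
    DifferentiableOn ℂ u (Metric.ball 0 R⁻¹) ∧ u 0 = 1 ∧
    ∀ (U : Set ℂ) (L : ℂ → ℂ), IsOpen U → U ⊆ {z | R < ‖z‖} ∩ H.regular →
      IsLogBranch 0 L U →
      H.IsSolutionOn (fun z => Complex.exp (-(ρ * L z)) * u z⁻¹) U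

/-- The relation between the parameters of the source `H'` (the equation for `v(w)`) and of the
target `H` (the equation for `y(z)`) of Euler's integral transformation with kernel
`(z - w) ^ (-η)`. -/
def EulerRelated (η : ℂ) (H' H : Heun) : Prop :=
  H'.t = H.t ∧
  (η - H.α) * (η - H.β) = 0 ∧
  (∀ i, H'.ε i = H.ε i - η + 1) ∧
  ({H'.α, H'.β} : Set ℂ) = {2 - η, H.α + H.β - 2 * η + 1} ∧
  H'.q = H.q + (1 - η) * (H.ε 2 + H.ε 1 * H.t + (H.ε 0 - η) * (H.t + 1))

end Heun

/-- `x` is not a rational integer. -/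
def NotInt (x : ℂ) : Prop := ∀ n : ℤ, x ≠ n

/-! The integral transformation is never used. Both sides of each assertion are reduced to the
kernel of a finite tridiagonal matrix, and the two matrices are conjugate up to a scalar.

In the variable `x = z - sing a`, Heun's equation for `∑ e n * x ^ n` is a three-term recurrence
with coefficients `up`, `mid`, `low`, where `up n` contains the factor `n + ε a` and `low n = (n +
α) * (n + β)`. If `ε a = -m`, then `up m = 0`, so row `m` does not see `e (m + 1)`: a holomorphic
solution with value 1 at `sing a` exists exactly when the block with indices `0, …, m` has a kernel
vector with `e 0 ≠ 0`. The later coefficients follow from the recurrence and grow at most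
geometrically. If instead `low m = 0`, a non-zero kernel vector of the block, continued by zero, is
a polynomial solution. The other exponents and the point at infinity are brought to this situation
by `gauge` and `inv`.

Each assertion thus compares a block of `H'` with a block of `H`. The relation between the
parameters, including the formula for `q'`, makes their diagonals agree up to a constant `σ`, and
the products of opposite off-diagonal entries agree up to `σ ^ 2`, in the same or in reversed order.
Hence a diagonal matrix carries one kernel to the other (`BlockKernel.rescale`,
`BlockKernel.rescale_reverse`). Non-integrality keeps the scaling factors finite and non-zero, and
fixes the degrees of the polynomials. Exchanging the exponents at infinity reduces everything to `η
= α`, the case `EulerNormal`. -/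

/-! ### Tridiagonal blocks and three-term recurrences -/

/-- The `n`-th row of the tridiagonal system with superdiagonal `u`, diagonal `d` and
subdiagonal `l`, applied to the sequence `e`. -/
def triRow (u d l e : ℕ → ℂ) : ℕ → ℂ
  | 0 => u 0 * e 1 + d 0 * e 0
  | n + 1 => u (n + 1) * e (n + 2) + d (n + 1) * e (n + 1) + l n * e n

/-- `e` is in the kernel of the block of the tridiagonal system with indices `0, …, m`. -/
def BlockKernel (u d l : ℕ → ℂ) (m : ℕ) (e : ℕ → ℂ) : Prop :=
  (∀ n, m < n → e n = 0) ∧ ∀ n ≤ m, triRow u d l e n = 0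

/-- Diagonal rescaling of a tridiagonal block. -/
theorem BlockKernel.rescale {u d l u' d' l' e' : ℕ → ℂ} {m : ℕ} {σ : ℂ} {κ : ℕ → ℂ} (hσ : σ ≠ 0)
    (hκ : ∀ n < m, κ n ≠ 0) (hd : ∀ n ≤ m, d' n = σ * d n)
    (hu : ∀ n < m, u' n = σ * κ n * u n) (hl : ∀ n < m, σ * l n = κ n * l' n)
    (h : BlockKernel u' d' l' m e') :
    ∃ e, BlockKernel u d l m e ∧ ∀ n ≤ m, e n = 0 ↔ e' n = 0 := by
  have hprod : ∀ n ≤ m, ∏ i ∈ Finset.range n, κ i ≠ 0 := fun n hn =>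
    Finset.prod_ne_zero_iff.2 fun i hi => hκ i ((Finset.mem_range.1 hi).trans_le hn)
  refine ⟨fun n => (∏ i ∈ Finset.range n, κ i) * e' n, ⟨fun n hn => by simp [h.1 n hn], ?_⟩,
    fun n hn => by simp [hprod n hn]⟩
  -- In the last row the superdiagonal entry multiplies `e' (m + 1) = 0`, so `u m` and `u' m` need
  -- not be related.
  have key : ∀ n ≤ m, u n * ((∏ i ∈ Finset.range (n + 1), κ i) * e' (n + 1)) * σ =
      (∏ i ∈ Finset.range n, κ i) * (u' n * e' (n + 1)) := by
    intro n hn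
    rcases hn.lt_or_eq with hn | rfl
    · rw [Finset.prod_range_succ, hu n hn]; ring
    · rw [h.1 _ (Nat.lt_succ_self _)]; ring
  intro n hn
  have h0 := h.2 n hn
  refine (mul_eq_zero.1 (?_ : _ * σ = 0)).resolve_right hσ
  cases n with
  | zero =>
    simp only [triRow] at h0 ⊢
    have h1 := key 0 hn
    have h2 := hd 0 hn
    simp only [Finset.prod_range_zero, zero_add, one_mul] at h1 ⊢
    rw [h2] at h0
    linear_combination h1 + h0
  | succ k =>
    simp only [triRow] at h0 ⊢
    have h1 := key (k + 1) hn
    have h2 := hd (k + 1) hn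
    have h3 := hl k hn
    have h4 : ∏ i ∈ Finset.range (k + 1), κ i = (∏ i ∈ Finset.range k, κ i) * κ k :=
      Finset.prod_range_succ _ _
    rw [h2] at h0
    linear_combination -(l' k * e' k) * h4 + h1 + (∏ i ∈ Finset.range k, κ i) * e' k * h3
      + (∏ i ∈ Finset.range (k + 1), κ i) * h0

/-- Reversing the order of the indices of a tridiagonal block. -/
theorem BlockKernel.reverse {u d l e : ℕ → ℂ} {m : ℕ} (h : BlockKernel u d l m e) :
    BlockKernel (fun n => l (m - 1 - n)) (fun n => d (m - n)) (fun n => u (m - 1 - n)) m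
      (fun n => if n ≤ m then e (m - n) else 0) := by
  refine ⟨fun n hn => if_neg (not_le.2 hn), fun n hn => ?_⟩
  have h0 := h.2 (m - n) (Nat.sub_le _ _)
  obtain ⟨k, rfl⟩ := Nat.exists_eq_add_of_le hn
  have hk : n + k - n = k := by omega
  rw [hk] at h0
  cases n with
  | zero =>
    cases k with
    | zero => simpa [triRow, h.1 1 one_pos] using h0
    | succ k =>
      have h1 := h.1 (k + 2) (by omega)
      simp only [triRow, h1] at h0 ⊢
      simp only [zero_add, add_tsub_cancel_right, tsub_zero, Nat.zero_le, if_true,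
        le_add_iff_nonneg_left]
      linear_combination h0
  | succ n =>
    have e1 : n + 1 + k - 1 - n = k := by omega
    have e2 : n + 1 + k - n = k + 1 := by omega
    have c1 : n ≤ n + 1 + k := by omega
    have c2 : n + 1 ≤ n + 1 + k := by omega
    simp only [triRow, e1, e2, hk, if_pos c1, if_pos c2]
    cases k with
    | zero =>
      simp only [triRow, zero_add] at h0 ⊢
      rw [if_neg (by omega)]
      linear_combination h0
    | succ k =>
      have e3 : n + 1 + (k + 1) - 1 - (n + 1) = k := by omega
      have e4 : n + 1 + (k + 1) - (n + 2) = k := by omega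
      have c3 : n + 2 ≤ n + 1 + (k + 1) := by omega
      simp only [triRow, e3, e4, if_pos c3] at h0 ⊢
      linear_combination h0

/-- Rescaling of a tridiagonal block combined with reversal of the indices. -/
theorem BlockKernel.rescale_reverse {u d l u' d' l' e' : ℕ → ℂ} {m : ℕ} {σ : ℂ} {κ : ℕ → ℂ}
    (hσ : σ ≠ 0) (hκ : ∀ n < m, κ n ≠ 0) (hd : ∀ n ≤ m, d' n = σ * d (m - n))
    (hu : ∀ n < m, u' n = σ * κ n * l (m - 1 - n))
    (hl : ∀ n < m, σ * u (m - 1 - n) = κ n * l' n) (h : BlockKernel u' d' l' m e') :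
    ∃ e, BlockKernel u d l m e ∧ ∀ n ≤ m, e n = 0 ↔ e' (m - n) = 0 := by
  obtain ⟨e, he, h0⟩ := BlockKernel.rescale (u := fun n => l (m - 1 - n))
    (d := fun n => d (m - n)) (l := fun n => u (m - 1 - n)) hσ hκ hd hu hl h
  have hr := he.reverse
  refine ⟨fun n => if n ≤ m then e (m - n) else 0, ⟨hr.1, fun n hn => ?_⟩, fun n hn => ?_⟩
  · refine Eq.trans ?_ (hr.2 n hn)
    have hs : ∀ k < m, m - 1 - (m - 1 - k) = k := fun k hk => by omega
    cases n with
    | zero =>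
      rcases Nat.eq_zero_or_pos m with rfl | hm
      · simp [triRow]
      · simp only [triRow, hs 0 hm, Nat.sub_sub_self (Nat.zero_le m)]
    | succ k =>
      simp only [triRow, hs k hn, Nat.sub_sub_self hn]
      -- In the last row the truncated subtraction gives a wrong superdiagonal entry, but it
      -- multiplies a coefficient outside the block, which is zero.
      rcases hn.lt_or_eq with h1 | h1
      · rw [hs _ h1]
      · rw [if_neg (by omega)]; ring
  · simp only [if_pos hn]
    exact h0 _ (Nat.sub_le _ _)

/-- The extension of a sequence from the indices `0, …, M` by the recurrence `triRow`. -/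
noncomputable def triExtend (u d l e : ℕ → ℂ) (M : ℕ) : ℕ → ℂ
  | 0 => e 0
  | 1 => if 1 ≤ M then e 1 else -(d 0 * e 0) / u 0
  | n + 2 => if n + 2 ≤ M then e (n + 2) else
      -(d (n + 1) * triExtend u d l e M (n + 1) + l n * triExtend u d l e M n) / u (n + 1)

theorem triExtend_of_le (u d l e : ℕ → ℂ) {M n : ℕ} (hn : n ≤ M) :
    triExtend u d l e M n = e n := by
  match n with
  | 0 => rw [triExtend]
  | 1 => rw [triExtend, if_pos hn]
  | n + 2 => rw [triExtend, if_pos hn]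

/-- Row `n` can be solved for `e (n + 1)` as soon as `u n ≠ 0`; the rows before `M` only involve the
prescribed values. -/
theorem triRow_triExtend {u d l e : ℕ → ℂ} {M : ℕ} (hu : ∀ n, M ≤ n → u n ≠ 0)
    (he : ∀ n < M, triRow u d l e n = 0) (n : ℕ) : triRow u d l (triExtend u d l e M) n = 0 := by
  rcases lt_or_ge n M with hn | hn
  · rw [← he n hn]
    cases n with
    | zero => simp only [triRow, triExtend_of_le u d l e hn, triExtend_of_le u d l e hn.le]
    | succ k =>
      simp only [triRow]
      rw [triExtend_of_le u d l e hn.le, triExtend_of_le u d l e (by omega : k ≤ M),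
        triExtend_of_le u d l e hn]
  · have h0 := hu n hn
    cases n with
    | zero =>
      simp only [triRow, triExtend, if_neg (by omega : ¬ 1 ≤ M)]
      field_simp
      ring
    | succ k =>
      simp only [triRow]
      rw [triExtend, if_neg (by omega)]
      field_simp
      ring

/-- A solution of a three-term recurrence with coefficients of quadratic growth grows at most
geometrically. -/
theorem exists_geometric_bound {u d l e : ℕ → ℂ} {K : ℝ} {N : ℕ}
    (hu : ∀ n, N ≤ n → u n ≠ 0) (hd : ∀ n, N ≤ n → ‖d n‖ ≤ K * ‖u n‖)
    (hl : ∀ n, N ≤ n → ‖l n‖ ≤ K * ‖u (n + 1)‖) (he : ∀ n, triRow u d l e n = 0) :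
    ∃ M > (0 : ℝ), ∃ Q > (0 : ℝ), ∀ n, ‖e n‖ ≤ M * Q ^ n := by
  set J := max K 1 with hJ
  have hJ1 : 1 ≤ J := le_max_right _ _
  have hKJ : K ≤ J := le_max_left _ _
  have hstep : ∀ n, N ≤ n → ‖e (n + 2)‖ ≤ J * (‖e (n + 1)‖ + ‖e n‖) := by
    intro n hn
    have h0 := he (n + 1)
    simp only [triRow] at h0
    have hpos : 0 < ‖u (n + 1)‖ := norm_pos_iff.2 (hu _ (by omega))
    have h1 : u (n + 1) * e (n + 2) = -(d (n + 1) * e (n + 1) + l n * e n) := by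
      linear_combination h0
    have h2 : ‖u (n + 1)‖ * ‖e (n + 2)‖ ≤ ‖d (n + 1)‖ * ‖e (n + 1)‖ + ‖l n‖ * ‖e n‖ := by
      rw [← norm_mul, h1, norm_neg, ← norm_mul, ← norm_mul]
      exact norm_add_le _ _
    have h3 : ‖d (n + 1)‖ * ‖e (n + 1)‖ ≤ J * ‖u (n + 1)‖ * ‖e (n + 1)‖ := by
      gcongr
      exact (hd _ (by omega)).trans (by gcongr)
    have h4 : ‖l n‖ * ‖e n‖ ≤ J * ‖u (n + 1)‖ * ‖e n‖ := by
      gcongr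
      exact (hl _ hn).trans (by gcongr)
    refine le_of_mul_le_mul_left ?_ hpos
    linarith
  set S := 1 + ∑ i ∈ Finset.range (N + 2), ‖e i‖ with hS
  have hSn : 0 ≤ ∑ i ∈ Finset.range (N + 2), ‖e i‖ := Finset.sum_nonneg fun _ _ => norm_nonneg _
  -- The ratio `2 * J` is preserved by the recurrence because `J * (2 * J + 1) ≤ (2 * J) ^ 2` for `J
  -- ≥ 1`; the constant `S` absorbs the first `N + 2` terms.
  refine ⟨S, by linarith, 2 * J, by linarith, fun n => ?_⟩
  induction n using Nat.strong_induction_on with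
  | _ n ih =>
    rcases lt_or_ge n (N + 2) with hn | hn
    · have h1 : ‖e n‖ ≤ ∑ i ∈ Finset.range (N + 2), ‖e i‖ :=
        Finset.single_le_sum (f := fun i => ‖e i‖) (fun _ _ => norm_nonneg _)
          (Finset.mem_range.2 hn)
      have h2 : (1 : ℝ) ≤ (2 * J) ^ n := one_le_pow₀ (by linarith)
      nlinarith
    · obtain ⟨k, rfl⟩ := Nat.exists_eq_add_of_le hn
      have e1 : N + 2 + k = (N + k) + 2 := by ring
      rw [e1]
      have h1 := ih (N + k) (by omega)
      have h2 := ih (N + k + 1) (by omega)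
      have h3 := hstep (N + k) (by omega)
      have h4 : 0 < (2 * J) ^ (N + k) := by positivity
      have h5 : J * (2 * J + 1) ≤ (2 * J) ^ 2 := by nlinarith
      calc ‖e (N + k + 2)‖ ≤ J * (S * (2 * J) ^ (N + k + 1) + S * (2 * J) ^ (N + k)) :=
            h3.trans (by gcongr)
        _ = S * (2 * J) ^ (N + k) * (J * (2 * J + 1)) := by ring
        _ ≤ S * (2 * J) ^ (N + k) * (2 * J) ^ 2 := by gcongr
        _ = S * (2 * J) ^ (N + k + 2) := by ring

/-! ### Heun's operator and its changes of parameters -/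

namespace Heun

/-- The accessory parameter of the equation written in the variable `z - sing a`. -/
def accessory (H : Heun) (a : Fin 3) : ℂ := H.q - H.α * H.β * H.sing a

/-- Heun's operator multiplied by `z (z - 1) (z - t)`, evaluated at the point `z` for the values
`y₀, y₁, y₂` of the function and its first two derivatives. -/
def opForm (H : Heun) (a b c : Fin 3) (z y₀ y₁ y₂ : ℂ) : ℂ :=
  (z - H.sing a) * (z - H.sing b) * (z - H.sing c) * y₂
    + (H.ε a * ((z - H.sing b) * (z - H.sing c)) + H.ε b * ((z - H.sing a) * (z - H.sing c))
      + H.ε c * ((z - H.sing a) * (z - H.sing b))) * y₁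
    + (H.α * H.β * (z - H.sing a) - H.accessory a) * y₀

/-- The equation with the exponents at infinity exchanged. -/
def swap (H : Heun) : Heun := { H with α := H.β, β := H.α }

/-- The equation for `u`, where `y = (z - sing i) ^ (1 - ε i) * u` solves `H`. -/
def gauge (H : Heun) (i : Fin 3) : Heun where
  t := H.t
  ε := Function.update H.ε i (2 - H.ε i)
  α := H.α + 1 - H.ε i
  β := H.β + 1 - H.ε i
  q := H.q + (1 - H.ε i) * ![H.ε 1 * H.t + H.ε 2, H.ε 0 * H.t, H.ε 0] i

/-- The equation for `u`, where `y = z ^ (-α) * u (1 / z)` solves `H`. -/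
noncomputable def inv (H : Heun) : Heun where
  t := H.t⁻¹
  ε := ![1 + H.α - H.β, H.ε 1, H.ε 2]
  α := H.α
  β := H.α - H.ε 0 + 1
  q := (H.q - H.α * ((H.ε 0 - H.α - 1) * (1 + H.t) + H.ε 1 * H.t + H.ε 2)) / H.t

section triple

variable {H : Heun} {a b c : Fin 3}

theorem opForm_eq (H : Heun) (hab : a ≠ b) (hbc : b ≠ c) (hca : c ≠ a) (z y₀ y₁ y₂ : ℂ) :
    H.opForm a b c z y₀ y₁ y₂ = H.opForm 0 1 2 z y₀ y₁ y₂ := by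
  fin_cases a <;> fin_cases b <;> fin_cases c <;>
    first
    | exact absurd rfl hab
    | exact absurd rfl hbc
    | exact absurd rfl hca
    | (simp [opForm, accessory, sing]; try ring)

theorem sum_ε (hH : H.IsAdmissible) (hab : a ≠ b) (hbc : b ≠ c) (hca : c ≠ a) :
    H.ε a + H.ε b + H.ε c = H.α + H.β + 1 := by
  have h := hH.2.2
  fin_cases a <;> fin_cases b <;> fin_cases c <;>
    first
    | exact absurd rfl hab
    | exact absurd rfl hbc
    | exact absurd rfl hca
    | (simp; linear_combination h)

theorem sing_injective (hH : H.IsAdmissible) : Function.Injective H.sing := by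
  obtain ⟨h0, h1, -⟩ := hH
  intro i j hij
  fin_cases i <;> fin_cases j <;> simp_all [sing, eq_comm]

theorem sing_notMem_regular (i : Fin 3) : H.sing i ∉ H.regular := by
  fin_cases i <;> simp [sing, regular]

theorem sub_sing_ne_zero {z : ℂ} (hz : z ∈ H.regular) (i : Fin 3) : z - H.sing i ≠ 0 :=
  sub_ne_zero.2 fun h => sing_notMem_regular i (h ▸ hz)

theorem isOpen_regular (H : Heun) : IsOpen H.regular :=
  (Set.toFinite _).isClosed.isOpen_compl

/-- Clearing denominators, which do not vanish off the singularities, gives polynomial coefficients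
and a form symmetric in the singularities, so that any of them can serve as the origin. -/
theorem isSolutionOn_iff (H : Heun) (hab : a ≠ b) (hbc : b ≠ c) (hca : c ≠ a) {U : Set ℂ}
    (hU : U ⊆ H.regular) (y : ℂ → ℂ) :
    H.IsSolutionOn y U ↔ DifferentiableOn ℂ y U ∧
      ∀ z ∈ U, H.opForm a b c z (y z) (deriv y z) (deriv (deriv y) z) = 0 := by
  refine and_congr_right fun _ => forall₂_congr fun z hz => ?_
  have h0 : z ≠ 0 := by simpa [sing] using sub_sing_ne_zero (hU hz) 0
  have h1 : z - 1 ≠ 0 := by simpa [sing] using sub_sing_ne_zero (hU hz) 1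
  have ht : z - H.t ≠ 0 := by simpa [sing] using sub_sing_ne_zero (hU hz) 2
  rw [opForm_eq H hab hbc hca, ← mul_right_inj' (mul_ne_zero (mul_ne_zero h0 h1) ht), mul_zero]
  refine Eq.congr ?_ rfl
  simp only [opForm, accessory, sing, Matrix.cons_val_zero, Matrix.cons_val_one, Matrix.cons_val]
  field_simp
  ring

/-- Measured from the base point `sing a`, the accessory parameter changes by one formula for all
three singularities; this is what allows them to be treated together. -/
theorem accessory_gauge_self (hH : H.IsAdmissible) (hab : a ≠ b) (hbc : b ≠ c) (hca : c ≠ a) :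
    (H.gauge a).accessory a = H.accessory a
      + (1 - H.ε a) * (H.ε b * (H.sing c - H.sing a) + H.ε c * (H.sing b - H.sing a)) := by
  have h := hH.2.2
  have hβ : H.β = H.ε 0 + H.ε 1 + H.ε 2 - H.α - 1 := by linear_combination -h
  fin_cases a <;> fin_cases b <;> fin_cases c <;>
    first
    | exact absurd rfl hab
    | exact absurd rfl hbc
    | exact absurd rfl hca
    | (simp [accessory, gauge, sing, hβ, -mul_eq_mul_left_iff]; try ring)

theorem accessory_gauge_of_ne (hH : H.IsAdmissible) (hab : a ≠ b) (hbc : b ≠ c) (hca : c ≠ a) :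
    (H.gauge b).accessory a = H.accessory a
      + (1 - H.ε b) * H.ε a * (H.sing c - H.sing a) := by
  have h := hH.2.2
  have hβ : H.β = H.ε 0 + H.ε 1 + H.ε 2 - H.α - 1 := by linear_combination -h
  fin_cases a <;> fin_cases b <;> fin_cases c <;>
    first
    | exact absurd rfl hab
    | exact absurd rfl hbc
    | exact absurd rfl hca
    | (simp [accessory, gauge, sing, hβ, -mul_eq_mul_left_iff]; try ring)

@[simp] theorem sing_gauge (H : Heun) (i : Fin 3) : (H.gauge i).sing = H.sing := rfl

@[simp] theorem ε_gauge_self (H : Heun) (i : Fin 3) : (H.gauge i).ε i = 2 - H.ε i := by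
  simp [gauge]

theorem ε_gauge_of_ne (H : Heun) {i j : Fin 3} (h : j ≠ i) : (H.gauge i).ε j = H.ε j := by
  simp [gauge, h]

theorem IsAdmissible.gauge (hH : H.IsAdmissible) (i : Fin 3) : (H.gauge i).IsAdmissible := by
  refine ⟨hH.1, hH.2.1, ?_⟩
  have h := hH.2.2
  fin_cases i <;> simp [Heun.gauge] <;> linear_combination h

theorem IsAdmissible.swap (hH : H.IsAdmissible) : H.swap.IsAdmissible :=
  ⟨hH.1, hH.2.1, by simpa [Heun.swap, add_comm H.β] using hH.2.2⟩

theorem IsAdmissible.inv (hH : H.IsAdmissible) : H.inv.IsAdmissible := by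
  refine ⟨inv_ne_zero hH.1, fun h => hH.2.1 (inv_eq_one.1 h), ?_⟩
  have h := hH.2.2
  simp [Heun.inv]
  linear_combination h

theorem isSolutionOn_swap {y : ℂ → ℂ} {U : Set ℂ} :
    H.swap.IsSolutionOn y U ↔ H.IsSolutionOn y U := by
  simp [IsSolutionOn, swap, mul_comm H.β]

theorem isPolyTypeSolution_swap {μ : Fin 3 → ℂ} {h : Polynomial ℂ} :
    H.swap.IsPolyTypeSolution μ h ↔ H.IsPolyTypeSolution μ h := by
  simp only [IsPolyTypeSolution, isSolutionOn_swap]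
  rfl

theorem nonLogarithmicAt_swap {i : Fin 3} : H.swap.NonLogarithmicAt i ↔ H.NonLogarithmicAt i := by
  simp only [NonLogarithmicAt, isSolutionOn_swap]
  rfl

theorem nonLogarithmicAtInfinity_swap :
    H.swap.NonLogarithmicAtInfinity ↔ H.NonLogarithmicAtInfinity := by
  simp only [NonLogarithmicAtInfinity, isSolutionOn_swap]
  refine and_congr ⟨Ne.symm, Ne.symm⟩ ?_
  simp only [swap, Set.pair_comm H.β]
  rfl

end triple

/-! ### Branches of the logarithm and the gauge transformation -/

/-- The first two derivatives of a function on an open set, read off from formulas for them. -/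
theorem deriv_deriv_eq {y y₁ : ℂ → ℂ} {U : Set ℂ} (hU : IsOpen U)
    (h₁ : ∀ z ∈ U, HasDerivAt y (y₁ z) z) {z : ℂ} (hz : z ∈ U) :
    deriv y z = y₁ z ∧ deriv (deriv y) z = deriv y₁ z := by
  refine ⟨(h₁ z hz).deriv, Filter.EventuallyEq.deriv_eq ?_⟩
  filter_upwards [hU.mem_nhds hz] with w hw using (h₁ w hw).deriv

theorem IsLogBranch.hasDerivAt {p : ℂ} {L : ℂ → ℂ} {U : Set ℂ} (hU : IsOpen U)
    (hL : IsLogBranch p L U) {z : ℂ} (hz : z ∈ U) : HasDerivAt L (1 / (z - p)) z := by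
  have h1 : HasDerivAt L (deriv L z) z := (hL.1.differentiableAt (hU.mem_nhds hz)).hasDerivAt
  have h2 : HasDerivAt (fun w => Complex.exp (L w)) 1 z := by
    refine ((hasDerivAt_id z).sub_const p).congr_of_eventuallyEq ?_
    filter_upwards [hU.mem_nhds hz] with w hw using hL.2 w hw
  have h3 := h1.cexp.unique h2
  have h4 : z - p ≠ 0 := hL.2 z hz ▸ Complex.exp_ne_zero _
  rw [hL.2 z hz] at h3
  rwa [show deriv L z = 1 / (z - p) by field_simp; linear_combination h3] at h1

/-- About every point `z₀ ≠ p` there is a branch of `log (z - p)`. -/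
theorem exists_isLogBranch {p z₀ : ℂ} (h : z₀ ≠ p) :
    ∃ r > (0 : ℝ), ∃ L : ℂ → ℂ, IsLogBranch p L (Metric.ball z₀ r) := by
  have h0 : z₀ - p ≠ 0 := sub_ne_zero.2 h
  have hslit : ∀ z ∈ Metric.ball z₀ ‖z₀ - p‖, (z - p) / (z₀ - p) ∈ Complex.slitPlane := by
    intro z hz
    have e : (z - p) / (z₀ - p) = 1 + (z - z₀) / (z₀ - p) := by field_simp; ring
    rw [e]
    apply Complex.mem_slitPlane_of_norm_lt_one
    rw [norm_div, div_lt_one (norm_pos_iff.2 h0)]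
    simpa [dist_eq_norm] using hz
  refine ⟨‖z₀ - p‖, norm_pos_iff.2 h0,
    fun z => Complex.log ((z - p) / (z₀ - p)) + Complex.log (z₀ - p), ?_, fun z hz => ?_⟩
  · intro z hz
    have h1 : DifferentiableAt ℂ (fun z => (z - p) / (z₀ - p)) z := by fun_prop
    exact ((h1.clog (hslit z hz)).add_const _).differentiableWithinAt
  · rw [Complex.exp_add, Complex.exp_log h0, Complex.exp_log (Complex.slitPlane_ne_zero (hslit z hz))]
    field_simp

theorem IsLogBranch.mono {p : ℂ} {L : ℂ → ℂ} {U V : Set ℂ} (h : IsLogBranch p L U) (hVU : V ⊆ U) :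
    IsLogBranch p L V :=
  ⟨h.1.mono hVU, fun z hz => h.2 z (hVU hz)⟩

theorem IsSolutionOn.mono {H : Heun} {y : ℂ → ℂ} {U V : Set ℂ} (h : H.IsSolutionOn y U)
    (hVU : V ⊆ U) : H.IsSolutionOn y V :=
  ⟨h.1.mono hVU, fun z hz => h.2 z (hVU hz)⟩

/-- Being a solution is a local property. A punctured disc carries no branch of the logarithm, so
single-valued solutions are recovered from small discs in this way. -/
theorem isSolutionOn_of_locally {H : Heun} {y : ℂ → ℂ} {V : Set ℂ}
    (h : ∀ z ∈ V, ∃ U, IsOpen U ∧ z ∈ U ∧ H.IsSolutionOn y U) : H.IsSolutionOn y V := by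
  refine ⟨fun z hz => ?_, fun z hz => ?_⟩
  · obtain ⟨U, hU, hzU, hs⟩ := h z hz
    exact (hs.1.differentiableAt (hU.mem_nhds hzU)).differentiableWithinAt
  · obtain ⟨U, -, hzU, hs⟩ := h z hz
    exact hs.2 z hzU

/-- Splitting off the exponent `1 - ε i` at a finite singularity. -/
theorem isSolutionOn_gauge {H : Heun} (hH : H.IsAdmissible) {i : Fin 3} {U : Set ℂ} {L y : ℂ → ℂ}
    (hU : IsOpen U) (hUr : U ⊆ H.regular) (hL : IsLogBranch (H.sing i) L U) :
    H.IsSolutionOn (fun z => Complex.exp ((1 - H.ε i) * L z) * y z) U ↔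
      (H.gauge i).IsSolutionOn y U := by
  obtain ⟨j, k, hij, hjk, hki⟩ : ∃ j k, i ≠ j ∧ j ≠ k ∧ k ≠ i := by
    fin_cases i
    exacts [⟨1, 2, by decide⟩, ⟨0, 2, by decide⟩, ⟨0, 1, by decide⟩]
  rw [isSolutionOn_iff H hij hjk hki hUr, isSolutionOn_iff (H.gauge i) hij hjk hki hUr]
  have hg : ∀ z ∈ U, HasDerivAt (fun z => Complex.exp ((1 - H.ε i) * L z))
      (Complex.exp ((1 - H.ε i) * L z) * ((1 - H.ε i) * (1 / (z - H.sing i)))) z := fun z hz =>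
    ((IsLogBranch.hasDerivAt hU hL hz).const_mul _).cexp
  have hdiff : DifferentiableOn ℂ (fun z => Complex.exp ((1 - H.ε i) * L z) * y z) U ↔
      DifferentiableOn ℂ y U := by
    refine ⟨fun h => ?_, fun h => ?_⟩
    · have hi : DifferentiableOn ℂ (fun z => Complex.exp (-((1 - H.ε i) * L z))) U :=
        ((hL.1.const_mul _).neg).cexp
      refine (hi.mul h).congr fun z _ => ?_
      simp only [Pi.mul_apply]
      rw [← mul_assoc, ← Complex.exp_add]
      simp
    · exact DifferentiableOn.mul (fun z hz => (hg z hz).differentiableAt.differentiableWithinAt) h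
  rw [hdiff]
  refine and_congr_right fun hy => forall₂_congr fun z hz => ?_
  have hy1 : ∀ z ∈ U, HasDerivAt y (deriv y z) z := fun z hz =>
    (hy.differentiableAt (hU.mem_nhds hz)).hasDerivAt
  have hy2 : HasDerivAt (deriv y) (deriv (deriv y) z) z :=
    ((hy.deriv hU).differentiableAt (hU.mem_nhds hz)).hasDerivAt
  have hx := sub_sing_ne_zero (hUr hz) i
  obtain ⟨e1, e2⟩ := deriv_deriv_eq hU (fun z hz => (hg z hz).mul (hy1 z hz)) hz
  have hphi : HasDerivAt (fun z => (1 - H.ε i) * (1 / (z - H.sing i)))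
      ((1 - H.ε i) * (-1 / (z - H.sing i) ^ 2)) z := by
    simpa [one_div] using (((hasDerivAt_id z).sub_const (H.sing i)).inv hx).const_mul (1 - H.ε i)
  have h3 := (((hg z hz).mul hphi).mul (hy1 z hz)).add ((hg z hz).mul hy2)
  have e3 := h3.deriv
  have e2' : deriv (deriv fun z => Complex.exp ((1 - H.ε i) * L z) * y z) z = _ := e2.trans e3
  have e1' : (deriv fun z => Complex.exp ((1 - H.ε i) * L z) * y z) z = _ := e1
  rw [e1', e2']
  have hs := sum_ε hH hij hjk hki
  have hε : H.β = H.ε i + H.ε j + H.ε k - H.α - 1 := by linear_combination -hs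
  -- Conjugation of the operator by `(z - sing i) ^ (1 - ε i)`. The double pole cancels because `1 -
  -- ε i` is an exponent.
  have key : ∀ g y0 y1 y2 : ℂ, H.opForm i j k z (g * y0)
      (g * ((1 - H.ε i) * (1 / (z - H.sing i))) * y0 + g * y1)
      ((g * ((1 - H.ε i) * (1 / (z - H.sing i))) * ((1 - H.ε i) * (1 / (z - H.sing i))) +
        g * ((1 - H.ε i) * (-1 / (z - H.sing i) ^ 2))) * y0
        + g * ((1 - H.ε i) * (1 / (z - H.sing i))) * y1
        + (g * ((1 - H.ε i) * (1 / (z - H.sing i))) * y1 + g * y2))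
      = g * (H.gauge i).opForm i j k z y0 y1 y2 := by
    intro g y0 y1 y2
    simp only [opForm, accessory_gauge_self hH hij hjk hki, sing_gauge, ε_gauge_self,
      ε_gauge_of_ne H hij.symm, ε_gauge_of_ne H hki]
    simp only [gauge, hε]
    field_simp
    ring
  have := key (Complex.exp ((1 - H.ε i) * L z)) (y z) (deriv y z) (deriv (deriv y) z)
  rw [Pi.mul_apply, this, mul_eq_zero, or_iff_right (Complex.exp_ne_zero _)]

end Heun

/-! ### Power series about a singularity -/

open scoped Nat Topology

/-- `u` is the sum of the power series with coefficients `c` on the ball of radius `r` about `s`. -/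
def SeriesOn (c : ℕ → ℂ) (u : ℂ → ℂ) (s : ℂ) (r : ℝ) : Prop :=
  ∀ x : ℂ, ‖x‖ < r → HasSum (fun n => c n * x ^ n) (u (s + x))

namespace SeriesOn

variable {c c' : ℕ → ℂ} {u v : ℂ → ℂ} {s : ℂ} {r : ℝ}

theorem hasFPowerSeriesOnBall (hr : 0 < r) (h : SeriesOn c u s r) :
    HasFPowerSeriesOnBall u (FormalMultilinearSeries.ofScalars ℂ c) s (ENNReal.ofReal r) where
  r_le := by
    refine ENNReal.le_of_forall_nnreal_lt fun ρ hρ => ?_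
    refine FormalMultilinearSeries.le_radius_of_tendsto (l := 0) _ ?_
    have h1 : ‖((ρ : ℝ) : ℂ)‖ < r := by
      have : (ρ : ℝ) < r := by
        rw [← ENNReal.ofReal_coe_nnreal, ENNReal.ofReal_lt_ofReal_iff hr] at hρ
        exact hρ
      simpa using this
    have h2 := (h _ h1).summable.tendsto_atTop_zero.norm
    simpa [FormalMultilinearSeries.ofScalars_norm] using h2
  r_pos := by simpa using hr
  hasSum := by
    intro y hy
    rw [FormalMultilinearSeries.ofScalars_apply_eq']
    refine h y ?_
    rw [Metric.eball_ofReal] at hy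
    simpa using hy

theorem differentiableOn (hr : 0 < r) (h : SeriesOn c u s r) :
    DifferentiableOn ℂ u (Metric.ball s r) := by
  have := (h.hasFPowerSeriesOnBall hr).differentiableOn
  rwa [Metric.eball_ofReal] at this

theorem unique (hr : 0 < r) (h : SeriesOn c u s r) (h' : SeriesOn c' u s r) : c = c' :=
  FormalMultilinearSeries.ofScalars_series_injective (𝕜 := ℂ) ℂ
    ((h.hasFPowerSeriesOnBall hr).hasFPowerSeriesAt.eq_formalMultilinearSeries
      (h'.hasFPowerSeriesOnBall hr).hasFPowerSeriesAt)

theorem taylor (h : DifferentiableOn ℂ u (Metric.ball s r)) :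
    SeriesOn (fun n => (n ! : ℂ)⁻¹ * iteratedDeriv n u s) u s r := by
  intro x hx
  have := Complex.hasSum_taylorSeries_on_ball h (z := s + x) (by simpa using hx)
  simp only [add_sub_cancel_left, smul_eq_mul] at this
  refine this.congr_fun fun n => ?_
  ring

theorem deriv (hr : 0 < r) (h : SeriesOn c u s r) :
    SeriesOn (fun n => (n + 1) * c (n + 1)) (deriv u) s r := by
  have hd := h.differentiableOn hr
  have h1 := h.unique hr (taylor hd)
  have h2 := taylor (hd.deriv Metric.isOpen_ball)
  convert h2 using 2 with n
  simp only [h1, iteratedDeriv_succ', Nat.factorial_succ]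
  have : (n ! : ℂ) ≠ 0 := by exact_mod_cast Nat.factorial_ne_zero n
  have : (n + 1 : ℂ) ≠ 0 := by exact_mod_cast Nat.succ_ne_zero n
  push_cast
  field_simp

theorem add (h : SeriesOn c u s r) (h' : SeriesOn c' v s r) :
    SeriesOn (fun n => c n + c' n) (fun z => u z + v z) s r := by
  intro x hx
  simpa only [add_mul] using (h x hx).add (h' x hx)

theorem const_mul (k : ℂ) (h : SeriesOn c u s r) :
    SeriesOn (fun n => k * c n) (fun z => k * u z) s r := by
  intro x hx
  simpa only [mul_assoc] using (h x hx).mul_left k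

/-- The coefficients of `x * ∑ c n * x ^ n`. -/
def shift (c : ℕ → ℂ) : ℕ → ℂ
  | 0 => 0
  | n + 1 => c n

theorem mul_sub (h : SeriesOn c u s r) : SeriesOn (shift c) (fun z => (z - s) * u z) s r := by
  intro x hx
  have h1 := (h x hx).mul_left x
  rw [← hasSum_nat_add_iff' 1]
  simp only [add_sub_cancel_left, Finset.range_one, Finset.sum_singleton, shift, zero_mul, sub_zero]
  refine h1.congr_fun fun n => ?_
  ring

/-- Identity theorem. A punctured neighbourhood is used because the equation is not imposed at the
singularity itself. -/
theorem eq_zero (hr : 0 < r) (h : SeriesOn c u s r) (hu : ∀ᶠ z in 𝓝[≠] s, u z = 0) (n : ℕ) :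
    c n = 0 := by
  have hp := (h.hasFPowerSeriesOnBall hr).hasFPowerSeriesAt
  have h1 : ∀ᶠ z in 𝓝 s, u z = 0 :=
    (hp.analyticAt.frequently_zero_iff_eventually_zero).1 hu.frequently
  have h2 := hp.eq_zero_of_eventually h1
  exact (FormalMultilinearSeries.ofScalars_eq_zero ℂ n).1 (by rw [h2]; rfl)

theorem of_bound {M Q : ℝ} (hQ : 0 < Q) (h : ∀ n, ‖c n‖ ≤ M * Q ^ n) :
    SeriesOn c (fun z => ∑' n, c n * (z - s) ^ n) s Q⁻¹ := by
  intro x hx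
  simp only [add_sub_cancel_left]
  refine Summable.hasSum ?_
  have h1 : Q * ‖x‖ < 1 := by rwa [mul_comm, ← lt_div_iff₀ hQ, one_div]
  refine Summable.of_norm_bounded
    ((summable_geometric_of_lt_one (by positivity) h1).mul_left M) fun n => ?_
  rw [norm_mul, norm_pow, mul_pow, ← mul_assoc]
  gcongr
  exact h n

theorem polynomial (p : Polynomial ℂ) (s : ℂ) (r : ℝ) :
    SeriesOn (Polynomial.taylor s p).coeff (fun z => p.eval z) s r := by
  intro x _
  have h1 : p.eval (s + x) = (Polynomial.taylor s p).eval x := by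
    rw [Polynomial.taylor_eval, add_comm]
  simp only [h1, Polynomial.eval_eq_sum_range]
  refine hasSum_sum_of_ne_finset_zero fun n hn => ?_
  rw [Polynomial.coeff_eq_zero_of_natDegree_lt, zero_mul]
  simpa [Nat.lt_succ_iff] using hn

end SeriesOn

/-! ### The recurrence: local and polynomial solutions as block kernels -/

namespace Heun

/-- The superdiagonal of the recurrence for the power series solutions at `sing a`. -/
def up (H : Heun) (a b c : Fin 3) (n : ℕ) : ℂ :=
  (n + 1) * (n + H.ε a) * ((H.sing b - H.sing a) * (H.sing c - H.sing a))

/-- The diagonal of the recurrence for the power series solutions at `sing a`. -/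
def mid (H : Heun) (a b c : Fin 3) (n : ℕ) : ℂ :=
  -(n * ((n - 1 + H.ε a) * (H.sing b - H.sing a + (H.sing c - H.sing a))
    + H.ε b * (H.sing c - H.sing a) + H.ε c * (H.sing b - H.sing a)) + H.accessory a)

/-- The subdiagonal of the recurrence for the power series solutions. -/
def low (H : Heun) (n : ℕ) : ℂ := (n + H.α) * (n + H.β)

variable {H : Heun} {a b c : Fin 3}

/-- In `x = z - sing a` the coefficient of the second derivative is a cubic vanishing at `0`, so the
operator shifts degrees by `-1`, `0` and `1` only. The relation `ε a + ε b + ε c = α + β + 1` makes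
the upward shift factor as `(n + α) * (n + β)`. -/
theorem seriesOn_opForm (hH : H.IsAdmissible) (hab : a ≠ b) (hbc : b ≠ c) (hca : c ≠ a)
    {e : ℕ → ℂ} {u : ℂ → ℂ} {r : ℝ} (hr : 0 < r) (h : SeriesOn e u (H.sing a) r) :
    SeriesOn (triRow (H.up a b c) (H.mid a b c) H.low e)
      (fun z => H.opForm a b c z (u z) (deriv u z) (deriv (deriv u) z)) (H.sing a) r := by
  have h1 := h.deriv hr
  have h2 := h1.deriv hr
  have hx2 := h2.mul_sub
  have hxx2 := hx2.mul_sub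
  have hxxx2 := hxx2.mul_sub
  have hx1 := h1.mul_sub
  have hxx1 := hx1.mul_sub
  have hx0 := h.mul_sub
  set A := H.sing b - H.sing a with hA
  set B := H.sing c - H.sing a with hB
  have hs := sum_ε hH hab hbc hca
  have hε : H.ε c = H.α + H.β + 1 - H.ε a - H.ε b := by linear_combination hs
  have key := ((((hxxx2.add (hxx2.const_mul (-(A + B)))).add (hx2.const_mul (A * B))).add
    (hxx1.const_mul (H.α + H.β + 1))).add
    ((hx1.const_mul (-(H.ε a * (A + B) + H.ε b * B + H.ε c * A))).add
      (h1.const_mul (H.ε a * (A * B))))).add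
    ((hx0.const_mul (H.α * H.β)).add (h.const_mul (-H.accessory a)))
  convert key using 1
  · funext n
    match n with
    | 0 => simp [triRow, up, mid, SeriesOn.shift, ← hA, ← hB]
    | 1 =>
      simp [triRow, up, mid, low, SeriesOn.shift, ← hA, ← hB]; ring
    | 2 =>
      simp [triRow, up, mid, low, SeriesOn.shift, ← hA, ← hB]; ring
    | n + 3 =>
      simp only [triRow, up, mid, low, SeriesOn.shift, ← hA, ← hB]
      push_cast
      ring
  · funext z
    simp only [opForm, hε]
    have e1 : z - H.sing b = (z - H.sing a) - A := by rw [hA]; ring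
    have e2 : z - H.sing c = (z - H.sing a) - B := by rw [hB]; ring
    rw [e1, e2]
    ring

/-- There is a holomorphic solution at `sing i` with value `1` there. -/
def HolomorphicAt (H : Heun) (i : Fin 3) : Prop :=
  ∃ r > (0 : ℝ), ∃ u : ℂ → ℂ, DifferentiableOn ℂ u (Metric.ball (H.sing i) r) ∧
    u (H.sing i) = 1 ∧ H.IsSolutionOn u (Metric.ball (H.sing i) r ∩ H.regular)

theorem eventually_regular (hH : H.IsAdmissible) (i : Fin 3) :
    ∀ᶠ z in 𝓝[≠] H.sing i, z ∈ H.regular := by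
  have h : ∀ j, ∀ᶠ z in 𝓝[≠] H.sing i, z ≠ H.sing j := by
    intro j
    by_cases hij : j = i
    · subst hij; exact self_mem_nhdsWithin
    · exact (eventually_ne_nhds fun h => hij (sing_injective hH h).symm).filter_mono
        nhdsWithin_le_nhds
  filter_upwards [h 0, h 1, h 2] with z h0 h1 h2
  simp only [sing, Matrix.cons_val_zero, Matrix.cons_val_one, Matrix.cons_val] at h0 h1 h2
  simp [regular, h0, h1, h2]

theorem triRow_eq_zero_of_isSolutionOn (hH : H.IsAdmissible) (hab : a ≠ b) (hbc : b ≠ c)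
    (hca : c ≠ a) {e : ℕ → ℂ} {u : ℂ → ℂ} {r : ℝ} (hr : 0 < r) (h : SeriesOn e u (H.sing a) r)
    (hu : H.IsSolutionOn u (Metric.ball (H.sing a) r ∩ H.regular)) (n : ℕ) :
    triRow (H.up a b c) (H.mid a b c) H.low e n = 0 := by
  refine (seriesOn_opForm hH hab hbc hca hr h).eq_zero hr ?_ n
  filter_upwards [eventually_regular hH a,
    mem_nhdsWithin_of_mem_nhds (Metric.ball_mem_nhds (H.sing a) hr)] with z h1 h2
  exact ((isSolutionOn_iff H hab hbc hca Set.inter_subset_right u).1 hu).2 z ⟨h2, h1⟩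

theorem isSolutionOn_of_triRow_eq_zero (hH : H.IsAdmissible) (hab : a ≠ b) (hbc : b ≠ c)
    (hca : c ≠ a) {e : ℕ → ℂ} {u : ℂ → ℂ} {r : ℝ} (hr : 0 < r) (h : SeriesOn e u (H.sing a) r)
    (he : ∀ n, triRow (H.up a b c) (H.mid a b c) H.low e n = 0) :
    H.IsSolutionOn u (Metric.ball (H.sing a) r ∩ H.regular) := by
  rw [isSolutionOn_iff H hab hbc hca Set.inter_subset_right]
  refine ⟨(h.differentiableOn hr).mono Set.inter_subset_left, fun z hz => ?_⟩
  have h1 := seriesOn_opForm hH hab hbc hca hr h (z - H.sing a)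
    (by simpa [dist_eq_norm] using hz.1)
  simp only [he, zero_mul, add_sub_cancel] at h1
  exact h1.unique hasSum_zero

/-- Here `up m = 0`, so the Taylor coefficients can be cut off after index `m` without disturbing
rows `0, …, m`. -/
theorem HolomorphicAt.exists_blockKernel (hH : H.IsAdmissible) (hab : a ≠ b) (hbc : b ≠ c)
    (hca : c ≠ a) {m : ℕ} (hm : H.ε a = -m) (h : H.HolomorphicAt a) :
    ∃ e, BlockKernel (H.up a b c) (H.mid a b c) H.low m e ∧ e 0 ≠ 0 := by
  obtain ⟨r, hr, u, hd, h1, hu⟩ := h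
  have hs := SeriesOn.taylor hd
  have hrow := triRow_eq_zero_of_isSolutionOn hH hab hbc hca hr hs hu
  set e : ℕ → ℂ := fun n => (n ! : ℂ)⁻¹ * iteratedDeriv n u (H.sing a) with he
  have hup : H.up a b c m = 0 := by simp [up, hm]
  refine ⟨fun n => if n ≤ m then e n else 0, ⟨fun n hn => if_neg (not_le.2 hn), fun n hn => ?_⟩,
    by simp [he, h1]⟩
  refine Eq.trans ?_ (hrow n)
  have hlast : H.up a b c n * (if n + 1 ≤ m then e (n + 1) else 0) = H.up a b c n * e (n + 1) := by
    split_ifs with h2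
    · rfl
    · rw [show n = m by omega, hup]; ring
  cases n with
  | zero =>
    simp only [zero_add] at hlast
    simp only [triRow, hlast, Nat.zero_le, if_true]
  | succ k =>
    simp only [add_assoc, one_add_one_eq_two] at hlast
    simp only [triRow, hlast, if_pos hn, if_pos (Nat.le_of_succ_le hn)]

/-- All three coefficients are at most quadratic in `n`, and the leading coefficient of `up`, the
product of the distances to the other two singularities, is not zero. -/
theorem exists_growth_bound (hH : H.IsAdmissible) (hab : a ≠ b) (hca : c ≠ a) :
    ∃ (K : ℝ) (N : ℕ), (∀ n, N ≤ n → H.up a b c n ≠ 0) ∧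
      (∀ n, N ≤ n → ‖H.mid a b c n‖ ≤ K * ‖H.up a b c n‖) ∧
      (∀ n, N ≤ n → ‖H.low n‖ ≤ K * ‖H.up a b c (n + 1)‖) := by
  obtain ⟨P, hP⟩ : ∃ P, P = (H.sing b - H.sing a) * (H.sing c - H.sing a) := ⟨_, rfl⟩
  have hP0 : 0 < ‖P‖ := norm_pos_iff.2 (hP ▸ mul_ne_zero
    (sub_ne_zero.2 fun h => hab (sing_injective hH h).symm)
    (sub_ne_zero.2 fun h => hca (sing_injective hH h)))
  -- For `n ≥ 2 * ‖ε a‖` the reverse triangle inequality gives `‖n + ε a‖ ≥ n / 2`; the extra `1`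
  -- ensures `N ≥ 1`.
  obtain ⟨N, hN⟩ := exists_nat_ge (2 * ‖H.ε a‖ + 1)
  have hup : ∀ n, N ≤ n → (n : ℝ) ^ 2 * (‖P‖ / 2) ≤ ‖H.up a b c n‖ := by
    intro n hn
    have hn' : (N : ℝ) ≤ n := by exact_mod_cast hn
    have h1 : (n : ℝ) / 2 ≤ ‖(n : ℂ) + H.ε a‖ := by
      have h2 := norm_sub_le_norm_add (n : ℂ) (H.ε a)
      rw [Complex.norm_natCast] at h2
      linarith
    have h3 : (n : ℝ) ≤ ‖(n : ℂ) + 1‖ := by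
      rw [← Nat.cast_succ, Complex.norm_natCast]; push_cast; linarith
    rw [up, ← hP, norm_mul, norm_mul]
    calc (n : ℝ) ^ 2 * (‖P‖ / 2) = n * (n / 2) * ‖P‖ := by ring
      _ ≤ _ := by gcongr
  have hquad : ∀ p q s : ℂ, ∀ n : ℕ, 1 ≤ n →
      ‖p * n ^ 2 + q * n + s‖ ≤ (‖p‖ + ‖q‖ + ‖s‖) * (n : ℝ) ^ 2 := by
    intro p q s n hn
    have hn' : (1 : ℝ) ≤ n := by exact_mod_cast hn
    have h1 : ‖p * n ^ 2 + q * n + s‖ ≤ ‖p‖ * n ^ 2 + ‖q‖ * n + ‖s‖ := by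
      refine (norm_add₃_le).trans ?_
      simp
    have h2 : (n : ℝ) ≤ n ^ 2 := by nlinarith
    have h3 : (1 : ℝ) ≤ n ^ 2 := by nlinarith
    nlinarith [mul_le_mul_of_nonneg_left h2 (norm_nonneg q),
      mul_le_mul_of_nonneg_left h3 (norm_nonneg s)]
  have hN1 : 1 ≤ N := by
    have : (1 : ℝ) ≤ N := by linarith [norm_nonneg (H.ε a)]
    exact_mod_cast this
  set A := H.sing b - H.sing a with hA
  set B := H.sing c - H.sing a with hB
  obtain ⟨K₁, hK₁⟩ : ∃ K₁ : ℝ, 0 ≤ K₁ ∧ ∀ n : ℕ, 1 ≤ n → ‖H.mid a b c n‖ ≤ K₁ * (n : ℝ) ^ 2 := by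
    refine ⟨_, ?_, fun n hn => le_trans (le_of_eq ?_) (hquad (-(A + B))
      (-((H.ε a - 1) * (A + B) + H.ε b * B + H.ε c * A)) (-H.accessory a) n hn)⟩
    · positivity
    · rw [mid, ← hA, ← hB]
      congr 1
      ring
  obtain ⟨K₂, hK₂⟩ : ∃ K₂ : ℝ, 0 ≤ K₂ ∧ ∀ n : ℕ, 1 ≤ n → ‖H.low n‖ ≤ K₂ * (n : ℝ) ^ 2 := by
    refine ⟨_, ?_, fun n hn => le_trans (le_of_eq ?_) (hquad 1 (H.α + H.β) (H.α * H.β) n hn)⟩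
    · positivity
    · rw [low]
      congr 1
      ring
  have hK : ∀ k ≤ K₁ + K₂, ∀ n, N ≤ n → k * (n : ℝ) ^ 2 ≤
      (K₁ + K₂) * (2 / ‖P‖) * ‖H.up a b c n‖ := by
    intro k hk n hn
    calc k * (n : ℝ) ^ 2 ≤ (K₁ + K₂) * (n : ℝ) ^ 2 := by gcongr
      _ = (K₁ + K₂) * (2 / ‖P‖) * ((n : ℝ) ^ 2 * (‖P‖ / 2)) := by field_simp
      _ ≤ _ := by
        have := hK₁.1
        have := hK₂.1
        gcongr
        exact hup n hn
  refine ⟨(K₁ + K₂) * (2 / ‖P‖), N, fun n hn h => ?_, fun n hn => ?_, fun n hn => ?_⟩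
  · have h1 := hup n hn
    have hn' : (0 : ℝ) < n := by exact_mod_cast (by omega : 0 < n)
    rw [h, norm_zero] at h1
    have : 0 < (n : ℝ) ^ 2 * (‖P‖ / 2) := by positivity
    linarith
  · exact (hK₁.2 n (by omega)).trans (hK _ (by linarith [hK₂.1]) n hn)
  · refine (hK₂.2 n (by omega)).trans (le_trans ?_ (hK K₂ (by linarith [hK₁.1]) (n + 1) (by omega)))
    have := hK₂.1
    gcongr
    simp

/-- From index `M` on no row is resonant, so the initial coefficients extend to a formal solution.
Geometric growth makes it converge on some disc, and division by `e 0` normalises its value. -/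
theorem holomorphicAt_of_triRow (hH : H.IsAdmissible) (hab : a ≠ b) (hbc : b ≠ c)
    (hca : c ≠ a) {e : ℕ → ℂ} (he0 : e 0 ≠ 0) {M : ℕ}
    (he : ∀ n < M, triRow (H.up a b c) (H.mid a b c) H.low e n = 0)
    (hM : ∀ n, M ≤ n → (n : ℂ) + H.ε a ≠ 0) : H.HolomorphicAt a := by
  have hup : ∀ n, M ≤ n → H.up a b c n ≠ 0 := fun n hn =>
    mul_ne_zero (mul_ne_zero (Nat.cast_add_one_ne_zero n) (hM n hn)) (mul_ne_zero
      (sub_ne_zero.2 fun h => hab (sing_injective hH h).symm)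
      (sub_ne_zero.2 fun h => hca (sing_injective hH h)))
  have hrow := triRow_triExtend hup he
  have h0 : triExtend (H.up a b c) (H.mid a b c) H.low e M 0 = e 0 :=
    triExtend_of_le _ _ _ _ (Nat.zero_le M)
  obtain ⟨K, N, hN1, hN2, hN3⟩ := exists_growth_bound hH hab hca
  obtain ⟨C, -, Q, hQ, hb⟩ := exists_geometric_bound hN1 hN2 hN3 hrow
  have hs := (SeriesOn.of_bound (s := H.sing a) hQ hb).const_mul (e 0)⁻¹
  have hr : 0 < Q⁻¹ := inv_pos.2 hQ
  refine ⟨Q⁻¹, hr, _, hs.differentiableOn hr, ?_,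
    isSolutionOn_of_triRow_eq_zero hH hab hbc hca hr hs fun n => ?_⟩
  · have h1 := (hs 0 (by simpa using hr)).unique (hasSum_single 0 fun n hn => by simp [hn])
    simpa [h0, he0] using h1
  · have h1 := hrow n
    cases n with
    | zero => simp only [triRow] at h1 ⊢; linear_combination (e 0)⁻¹ * h1
    | succ k => simp only [triRow] at h1 ⊢; linear_combination (e 0)⁻¹ * h1

theorem holomorphicAt_of_blockKernel (hH : H.IsAdmissible) (hab : a ≠ b) (hbc : b ≠ c)
    (hca : c ≠ a) {m : ℕ} (hm : H.ε a = -m) {e : ℕ → ℂ}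
    (he : BlockKernel (H.up a b c) (H.mid a b c) H.low m e) (he0 : e 0 ≠ 0) :
    H.HolomorphicAt a := by
  -- Row `m` leaves the coefficient of index `m + 1` free. The block kernel sets it to `0`, and the
  -- recursion restarts from there, whence `M = m + 1`.
  refine holomorphicAt_of_triRow hH hab hbc hca he0 (M := m + 1)
    (fun n hn => he.2 n (Nat.lt_succ_iff.1 hn)) fun n hn h => ?_
  rw [hm, ← sub_eq_add_neg, sub_eq_zero] at h
  have : n = m := by exact_mod_cast h
  omega

theorem holomorphicAt_of_nonresonant (hH : H.IsAdmissible) (i : Fin 3)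
    (h : ∀ n : ℕ, (n : ℂ) + H.ε i ≠ 0) : H.HolomorphicAt i := by
  obtain ⟨j, k, hij, hjk, hki⟩ : ∃ j k, i ≠ j ∧ j ≠ k ∧ k ≠ i := by
    fin_cases i
    exacts [⟨1, 2, by decide⟩, ⟨0, 2, by decide⟩, ⟨0, 1, by decide⟩]
  -- With `M = 0` only the value `e 0 = 1` of the constant sequence is used.
  exact holomorphicAt_of_triRow hH hij hjk hki (e := 1) one_ne_zero (M := 0)
    (fun n hn => absurd hn (Nat.not_lt_zero n)) fun n _ => h n

/-- The polynomial `h` solves the equation. -/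
def IsPolySolution (H : Heun) (h : Polynomial ℂ) : Prop :=
  H.IsSolutionOn (fun z => h.eval z) H.regular

theorem IsPolySolution.triRow_eq_zero (hH : H.IsAdmissible) (hab : a ≠ b) (hbc : b ≠ c)
    (hca : c ≠ a) {h : Polynomial ℂ} (hs : H.IsPolySolution h) (n : ℕ) :
    triRow (H.up a b c) (H.mid a b c) H.low (Polynomial.taylor (H.sing a) h).coeff n = 0 :=
  triRow_eq_zero_of_isSolutionOn hH hab hbc hca one_pos (SeriesOn.polynomial h _ 1)
    (IsSolutionOn.mono hs Set.inter_subset_right) n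

theorem isPolySolution_of_triRow (hH : H.IsAdmissible) (hab : a ≠ b) (hbc : b ≠ c)
    (hca : c ≠ a) {h : Polynomial ℂ}
    (hs : ∀ n, triRow (H.up a b c) (H.mid a b c) H.low (Polynomial.taylor (H.sing a) h).coeff n = 0) :
    H.IsPolySolution h := by
  refine isSolutionOn_of_locally fun z hz => ⟨Metric.ball (H.sing a) (dist z (H.sing a) + 1) ∩
    H.regular, Metric.isOpen_ball.inter H.isOpen_regular, ⟨by simp, hz⟩, ?_⟩
  exact isSolutionOn_of_triRow_eq_zero hH hab hbc hca (by positivity)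
    (SeriesOn.polynomial h _ _) hs

/-- The degree of a polynomial solution is minus an exponent at infinity. -/
theorem IsPolySolution.low_natDegree (hH : H.IsAdmissible) {h : Polynomial ℂ} (h0 : h ≠ 0)
    (hs : H.IsPolySolution h) : H.low h.natDegree = 0 := by
  -- In the row after the degree only `low` times the leading coefficient remains.
  have h1 := hs.triRow_eq_zero hH (a := 0) (b := 1) (c := 2) (by decide) (by decide) (by decide)
    (h.natDegree + 1)
  have hd : (Polynomial.taylor (H.sing 0) h).natDegree = h.natDegree :=
    Polynomial.natDegree_taylor h _
  have hz : ∀ k, h.natDegree < k → (Polynomial.taylor (H.sing 0) h).coeff k = 0 := fun k hk =>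
    Polynomial.coeff_eq_zero_of_natDegree_lt (hd ▸ hk)
  simp only [triRow, hz _ (Nat.lt_succ_self _), hz (h.natDegree + 2) (by omega)] at h1
  have hl : (Polynomial.taylor (H.sing 0) h).coeff h.natDegree ≠ 0 := by
    have := Polynomial.leadingCoeff_ne_zero.2
      ((map_ne_zero_iff _ (Polynomial.taylor_injective (H.sing 0))).2 h0)
    rwa [Polynomial.leadingCoeff, hd] at this
  simp only [mul_zero, zero_add, add_zero] at h1
  exact (mul_eq_zero.1 h1).resolve_right hl

/-- Both ends of the coefficient vector are non-zero: `e m` is the leading coefficient, and `e 0 =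
0` would make every coefficient vanish since no `up n` is zero. Which end matters later depends on
whether the block is reversed. -/
theorem IsPolySolution.exists_blockKernel (hH : H.IsAdmissible) (hab : a ≠ b) (hbc : b ≠ c)
    (hca : c ≠ a) {h : Polynomial ℂ} (h0 : h ≠ 0) (hs : H.IsPolySolution h) {m : ℕ}
    (hm : ∀ d : ℕ, H.low d = 0 → d = m) (hε : ∀ n : ℕ, (n : ℂ) + H.ε a ≠ 0) :
    ∃ e, BlockKernel (H.up a b c) (H.mid a b c) H.low m e ∧ e 0 ≠ 0 ∧ e m ≠ 0 := by
  have hrow := hs.triRow_eq_zero hH hab hbc hca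
  have hdeg := hm _ (hs.low_natDegree hH h0)
  have hd : (Polynomial.taylor (H.sing a) h).natDegree = m :=
    (Polynomial.natDegree_taylor h _).trans hdeg
  have ht : Polynomial.taylor (H.sing a) h ≠ 0 :=
    (map_ne_zero_iff _ (Polynomial.taylor_injective (H.sing a))).2 h0
  refine ⟨_, ⟨fun n hn => Polynomial.coeff_eq_zero_of_natDegree_lt (hd ▸ hn),
    fun n _ => hrow n⟩, fun he0 => ht ?_, ?_⟩
  · have hup : ∀ n, H.up a b c n ≠ 0 := fun n =>
      mul_ne_zero (mul_ne_zero (Nat.cast_add_one_ne_zero n) (hε n)) (mul_ne_zero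
        (sub_ne_zero.2 fun h => hab (sing_injective hH h).symm)
        (sub_ne_zero.2 fun h => hca (sing_injective hH h)))
    ext n
    rw [Polynomial.coeff_zero]
    induction n using Nat.strong_induction_on with
    | _ n ih =>
      match n with
      | 0 => exact he0
      | 1 => simpa [triRow, he0, hup 0] using hrow 0
      | n + 2 =>
        simpa [triRow, ih n (by omega), ih (n + 1) (by omega), hup (n + 1)] using hrow (n + 1)
  · have := Polynomial.leadingCoeff_ne_zero.2 ht
    rwa [Polynomial.leadingCoeff, hd] at this

/-- As `low m = 0`, row `m + 1` does not see `e m`; continuing the kernel vector by zero therefore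
satisfies all rows. -/
theorem exists_isPolySolution_of_blockKernel (hH : H.IsAdmissible) (hab : a ≠ b) (hbc : b ≠ c)
    (hca : c ≠ a) {m : ℕ} (hm : H.low m = 0) {e : ℕ → ℂ}
    (he : BlockKernel (H.up a b c) (H.mid a b c) H.low m e) {k : ℕ} (hk : e k ≠ 0) :
    ∃ h : Polynomial ℂ, h ≠ 0 ∧ H.IsPolySolution h ∧ h.natDegree ≤ m := by
  set g : Polynomial ℂ := ∑ i ∈ Finset.range (m + 1), Polynomial.monomial i (e i) with hg
  have hcoeff : g.coeff = e := by
    funext n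
    simp only [hg, Polynomial.finsetSum_coeff, Polynomial.coeff_monomial]
    rw [Finset.sum_ite_eq']
    split_ifs with h
    · rfl
    · exact (he.1 n (by simpa [Nat.lt_succ_iff] using h)).symm
  have htaylor : Polynomial.taylor (H.sing a) (Polynomial.taylor (-H.sing a) g) = g := by
    rw [Polynomial.taylor_taylor]; simp
  refine ⟨Polynomial.taylor (-H.sing a) g, fun h => hk ?_,
    isPolySolution_of_triRow hH hab hbc hca fun n => ?_, ?_⟩
  · rw [← hcoeff, ← htaylor, h]; simp
  · rw [htaylor, hcoeff]
    rcases le_or_gt n m with h | h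
    · exact he.2 n h
    · cases n with
      | zero => omega
      | succ n =>
        simp only [triRow, he.1 _ h, he.1 (n + 2) (by omega)]
        rcases (Nat.lt_succ_iff.1 h).lt_or_eq with h' | rfl
        · simp [he.1 n h']
        · simp [hm]
  · rw [Polynomial.natDegree_taylor]
    refine Polynomial.natDegree_sum_le_of_forall_le _ _ fun i hi => ?_
    exact (Polynomial.natDegree_monomial_le _).trans (by simpa [Nat.lt_succ_iff] using hi)

end Heun

/-! ### Non-logarithmic singularities and polynomial-type solutions after gauge and inversion -/

namespace Heun

variable {H : Heun} {a b c i : Fin 3}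

theorem exists_open_isLogBranch (p : ℂ) {W : Set ℂ} (hW : IsOpen W) {z : ℂ} (hz : z ∈ W)
    (hp : z ≠ p) : ∃ U ⊆ W, IsOpen U ∧ z ∈ U ∧ ∃ L, IsLogBranch p L U := by
  obtain ⟨r, hr, L, hL⟩ := exists_isLogBranch hp
  exact ⟨Metric.ball z r ∩ W, Set.inter_subset_right, Metric.isOpen_ball.inter hW,
    ⟨Metric.mem_ball_self hr, hz⟩, L, IsLogBranch.mono hL Set.inter_subset_left⟩

/-- Removing the power leaves a single-valued factor, so the branches fit together to a solution on
the punctured disc. -/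
theorem NonLogarithmicAt.holomorphicAt_gauge (hH : H.IsAdmissible) (h : H.NonLogarithmicAt i) :
    (H.gauge i).HolomorphicAt i := by
  obtain ⟨r, hr, u, hu, h1, hs⟩ := h.2 (1 - H.ε i) (by simp)
  refine ⟨r, hr, u, hu, h1, isSolutionOn_of_locally fun z hz => ?_⟩
  obtain ⟨U, hUW, hU, hzU, L, hL⟩ := exists_open_isLogBranch (H.sing i)
    (Metric.isOpen_ball.inter H.isOpen_regular) hz (sub_ne_zero.1 (sub_sing_ne_zero hz.2 i))
  exact ⟨U, hU, hzU, (isSolutionOn_gauge hH hU (hUW.trans Set.inter_subset_right) hL).1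
    (hs U L hU hUW hL)⟩

theorem NonLogarithmicAt.holomorphicAt (h : H.NonLogarithmicAt i) : H.HolomorphicAt i := by
  obtain ⟨r, hr, u, hu, h1, hs⟩ := h.2 0 (by simp)
  refine ⟨r, hr, u, hu, h1, isSolutionOn_of_locally fun z hz => ?_⟩
  obtain ⟨U, hUW, hU, hzU, L, hL⟩ := exists_open_isLogBranch (H.sing i)
    (Metric.isOpen_ball.inter H.isOpen_regular) hz (sub_ne_zero.1 (sub_sing_ne_zero hz.2 i))
  exact ⟨U, hU, hzU, by simpa using hs U L hU hUW hL⟩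

theorem nonLogarithmicAt_of_holomorphicAt (hH : H.IsAdmissible) (hε : H.ε i ≠ 1)
    (h : H.HolomorphicAt i) (hg : (H.gauge i).HolomorphicAt i) : H.NonLogarithmicAt i := by
  refine ⟨hε, fun ρ hρ => ?_⟩
  rcases hρ with rfl | rfl
  · obtain ⟨r, hr, u, hu, h1, hs⟩ := h
    exact ⟨r, hr, u, hu, h1, fun U L _ hUW _ => by simpa using hs.mono hUW⟩
  · obtain ⟨r, hr, u, hu, h1, hs⟩ := hg
    exact ⟨r, hr, u, hu, h1, fun U L hU hUW hL =>
      (isSolutionOn_gauge hH hU (hUW.trans Set.inter_subset_right) hL).2 (hs.mono hUW)⟩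

theorem isPolyTypeSolution_zero {h : Polynomial ℂ} :
    H.IsPolyTypeSolution 0 h ↔ H.IsPolySolution h := by
  refine ⟨fun hs => isSolutionOn_of_locally fun z hz => ?_, fun hs U L _ hUr _ => ?_⟩
  · have hne : ∀ j, z ≠ H.sing j := fun j => sub_ne_zero.1 (sub_sing_ne_zero hz j)
    -- The neighbourhoods are nested so that all three logarithms have branches on the last one.
    obtain ⟨U₀, hUW₀, hU₀, hzU₀, L₀, hL₀⟩ := exists_open_isLogBranch _ H.isOpen_regular hz (hne 0)
    obtain ⟨U₁, hUW₁, hU₁, hzU₁, L₁, hL₁⟩ := exists_open_isLogBranch _ hU₀ hzU₀ (hne 1)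
    obtain ⟨U₂, hUW₂, hU₂, hzU₂, L₂, hL₂⟩ := exists_open_isLogBranch _ hU₁ hzU₁ (hne 2)
    refine ⟨U₂, hU₂, hzU₂, ?_⟩
    have := hs U₂ ![L₀, L₁, L₂] hU₂ ((hUW₂.trans hUW₁).trans hUW₀) fun j => by
      fin_cases j
      exacts [IsLogBranch.mono hL₀ (hUW₂.trans hUW₁), IsLogBranch.mono hL₁ hUW₂, hL₂]
    simpa using this
  · simpa using hs.mono hUr

theorem isPolyTypeSolution_gauge (hH : H.IsAdmissible) {μ : Fin 3 → ℂ} (hμ : μ i = 1 - H.ε i)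
    {h : Polynomial ℂ} : H.IsPolyTypeSolution μ h ↔
      (H.gauge i).IsPolyTypeSolution (Function.update μ i 0) h := by
  refine forall_congr' fun U => forall_congr' fun L => forall_congr' fun hU =>
    forall_congr' fun hUr => forall_congr' fun hL => ?_
  rw [← isSolutionOn_gauge hH hU hUr (hL i)]
  have e : ∀ z, (∏ j, Complex.exp (μ j * L j z)) = Complex.exp ((1 - H.ε i) * L i z) *
      ∏ j, Complex.exp (Function.update μ i 0 j * L j z) := by
    intro z
    rw [← hμ, ← Finset.mul_prod_erase _ _ (Finset.mem_univ i),
      ← Finset.mul_prod_erase Finset.univ (fun j => Complex.exp (Function.update μ i 0 j * L j z))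
        (Finset.mem_univ i)]
    simp only [Function.update_self, zero_mul, Complex.exp_zero, one_mul]
    congr 1
    refine Finset.prod_congr rfl fun j hj => ?_
    rw [Function.update_of_ne (Finset.ne_of_mem_erase hj)]
  simp only [e, mul_assoc]

theorem isPolyTypeSolution_single (hH : H.IsAdmissible) {h : Polynomial ℂ} :
    H.IsPolyTypeSolution (Pi.single a (1 - H.ε a)) h ↔ (H.gauge a).IsPolySolution h := by
  rw [isPolyTypeSolution_gauge hH (i := a) (by simp), ← isPolyTypeSolution_zero]
  refine iff_of_eq (congrArg (fun μ => IsPolyTypeSolution _ μ h) ?_)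
  funext j
  by_cases hj : j = a
  · subst hj; simp
  · simp [hj]

theorem isPolyTypeSolution_pair (hH : H.IsAdmissible) (hbc : b ≠ c) {h : Polynomial ℂ} :
    H.IsPolyTypeSolution (Pi.single b (1 - H.ε b) + Pi.single c (1 - H.ε c)) h ↔
      ((H.gauge b).gauge c).IsPolySolution h := by
  rw [isPolyTypeSolution_gauge hH (i := b) (by simp [hbc]),
    ← isPolyTypeSolution_single (hH.gauge b), ε_gauge_of_ne H hbc.symm]
  refine iff_of_eq (congrArg (fun μ => IsPolyTypeSolution _ μ h) ?_)
  funext j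
  by_cases hj : j = b
  · subst hj; simp [hbc]
  · simp [hj]

/-- The equation for `u`, where `y = z ^ (1 - ε₀) * (z - 1) ^ (1 - ε₁) * (z - t) ^ (1 - ε_t) * u`
solves `H`. -/
def fullGauge (H : Heun) : Heun := ((H.gauge 0).gauge 1).gauge 2

theorem isPolyTypeSolution_full (hH : H.IsAdmissible) {h : Polynomial ℂ} :
    H.IsPolyTypeSolution (fun i => 1 - H.ε i) h ↔ H.fullGauge.IsPolySolution h := by
  rw [isPolyTypeSolution_gauge hH (i := 0) rfl, fullGauge,
    ← isPolyTypeSolution_pair (hH.gauge 0) (by decide), ε_gauge_of_ne H (by decide),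
    ε_gauge_of_ne H (by decide)]
  refine iff_of_eq (congrArg (fun μ => IsPolyTypeSolution _ μ h) ?_)
  funext j
  fin_cases j <;> simp

theorem inv_mem_regular_inv {z : ℂ} : z⁻¹ ∈ H.inv.regular ↔ z ∈ H.regular := by
  simp [regular, inv]

/-- Splitting off the exponent `α` at infinity. -/
theorem isSolutionOn_inv (hH : H.IsAdmissible) {U : Set ℂ} {L u : ℂ → ℂ} (hU : IsOpen U)
    (hUr : U ⊆ H.regular) (hL : IsLogBranch 0 L U)
    (hV : IsOpen (Inv.inv ⁻¹' U : Set ℂ)) (hu : DifferentiableOn ℂ u (Inv.inv ⁻¹' U)) :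
    H.IsSolutionOn (fun z => Complex.exp (-(H.α * L z)) * u z⁻¹) U ↔
      H.inv.IsSolutionOn u (Inv.inv ⁻¹' U) := by
  have hVr : (Inv.inv ⁻¹' U : Set ℂ) ⊆ H.inv.regular := fun w hw => by
    have := inv_mem_regular_inv.2 (hUr hw)
    rwa [inv_inv] at this
  have h01 : (0 : Fin 3) ≠ 1 := by decide
  have h12 : (1 : Fin 3) ≠ 2 := by decide
  have h20 : (2 : Fin 3) ≠ 0 := by decide
  have hz0 : ∀ z ∈ U, z ≠ 0 := fun z hz => by
    simpa [sing] using sub_sing_ne_zero (hUr hz) 0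
  rw [isSolutionOn_iff H h01 h12 h20 hUr, isSolutionOn_iff H.inv h01 h12 h20 hVr]
  have hmem : ∀ z ∈ U, z⁻¹ ∈ (Inv.inv ⁻¹' U : Set ℂ) := fun z hz => by simpa using hz
  have hg : ∀ z ∈ U, HasDerivAt (fun z => Complex.exp (-(H.α * L z)))
      (Complex.exp (-(H.α * L z)) * -(H.α * (1 / z))) z := fun z hz => by
    simpa using ((IsLogBranch.hasDerivAt hU hL hz).const_mul H.α).neg.cexp
  have hinv : ∀ z ∈ U, HasDerivAt (fun z : ℂ => z⁻¹) (-(1 / z ^ 2)) z := fun z hz => by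
    simpa [one_div] using hasDerivAt_inv (hz0 z hz)
  have hu1 : ∀ z ∈ U, HasDerivAt (fun z => u z⁻¹) (deriv u z⁻¹ * -(1 / z ^ 2)) z := fun z hz =>
    (hu.differentiableAt (hV.mem_nhds (hmem z hz))).hasDerivAt.comp z (hinv z hz)
  have hu2 : ∀ z ∈ U, HasDerivAt (fun z => deriv u z⁻¹)
      (deriv (deriv u) z⁻¹ * -(1 / z ^ 2)) z := fun z hz =>
    ((hu.deriv hV).differentiableAt (hV.mem_nhds (hmem z hz))).hasDerivAt.comp z (hinv z hz)
  have hy : ∀ z ∈ U, HasDerivAt (fun z => Complex.exp (-(H.α * L z)) * u z⁻¹)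
      (Complex.exp (-(H.α * L z)) * -(H.α * (1 / z)) * u z⁻¹
        + Complex.exp (-(H.α * L z)) * (deriv u z⁻¹ * -(1 / z ^ 2))) z := fun z hz =>
    (hg z hz).mul (hu1 z hz)
  have hiff : ∀ z ∈ U, H.opForm 0 1 2 z (Complex.exp (-(H.α * L z)) * u z⁻¹)
      (deriv (fun z => Complex.exp (-(H.α * L z)) * u z⁻¹) z)
      (deriv (deriv fun z => Complex.exp (-(H.α * L z)) * u z⁻¹) z) = 0 ↔
      H.inv.opForm 0 1 2 z⁻¹ (u z⁻¹) (deriv u z⁻¹) (deriv (deriv u) z⁻¹) = 0 := by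
    intro z hz
    have hz' := hz0 z hz
    have ht := hH.1
    obtain ⟨e1, e2⟩ := deriv_deriv_eq hU hy hz
    have hphi : HasDerivAt (fun z => -(H.α * (1 / z))) (H.α / z ^ 2) z := by
      have e : (fun z => -(H.α * (1 / z))) = -fun z => H.α * z⁻¹ := by funext w; simp
      rw [e]
      exact ((hinv z hz).const_mul H.α).neg.congr_deriv (by ring)
    have hpsi : HasDerivAt (fun z : ℂ => -(1 / z ^ 2)) (2 / z ^ 3) z := by
      have e : (fun z : ℂ => -(1 / z ^ 2)) = -(fun z => z⁻¹) ^ 2 := by funext w; simp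
      rw [e]
      refine ((hinv z hz).pow 2).neg.congr_deriv ?_
      norm_num
      field_simp
    have h3 : HasDerivAt _ _ z := (((hg z hz).mul hphi).mul (hu1 z hz)).add
      ((hg z hz).mul ((hu2 z hz).mul hpsi))
    have e2' : deriv (deriv fun z => Complex.exp (-(H.α * L z)) * u z⁻¹) z = _ := e2.trans h3.deriv
    rw [e1, e2']
    simp only [Pi.mul_apply]
    have hε : H.ε 2 = H.α + H.β + 1 - H.ε 0 - H.ε 1 := by linear_combination hH.2.2
    -- With `w = 1 / z` one has `(z - 1) * (z - t) = t * (w - 1) * (w - 1 / t) / w ^ 2`; this is the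
    -- origin of the factor `H.t`.
    have key : ∀ g y0 y1 y2 : ℂ, H.opForm 0 1 2 z (g * y0)
        (g * -(H.α * (1 / z)) * y0 + g * (y1 * -(1 / z ^ 2)))
        ((g * -(H.α * (1 / z)) * -(H.α * (1 / z)) + g * (H.α / z ^ 2)) * y0
          + g * -(H.α * (1 / z)) * (y1 * -(1 / z ^ 2))
          + (g * -(H.α * (1 / z)) * (y1 * -(1 / z ^ 2))
            + g * (y2 * -(1 / z ^ 2) * -(1 / z ^ 2) + y1 * (2 / z ^ 3))))
        = g * H.t * H.inv.opForm 0 1 2 z⁻¹ y0 y1 y2 := by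
      intro g y0 y1 y2
      simp only [opForm, accessory, inv, sing, Matrix.cons_val_zero, Matrix.cons_val_one,
        Matrix.cons_val, hε]
      field_simp
      ring
    rw [key, mul_eq_zero, or_iff_right (mul_ne_zero (Complex.exp_ne_zero _) ht)]
  refine ⟨fun h => ⟨hu, fun w hw => ?_⟩, fun h => ⟨fun z hz =>
    (hy z hz).differentiableAt.differentiableWithinAt, fun z hz =>
      (hiff z hz).2 (h.2 _ (hmem z hz))⟩⟩
  have := (hiff w⁻¹ hw).1 (h.2 _ hw)
  rwa [inv_inv] at this

theorem isOpen_preimage_inv {U : Set ℂ} (hU : IsOpen U) (h0 : (0 : ℂ) ∉ U) :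
    IsOpen (Inv.inv ⁻¹' U : Set ℂ) := by
  have h := (continuousOn_inv₀ (G₀ := ℂ)).isOpen_inter_preimage isOpen_compl_singleton hU
  rwa [Set.inter_eq_right.2] at h
  rintro w hw rfl
  exact h0 (by simpa using hw)

theorem zero_notMem_regular : (0 : ℂ) ∉ H.regular := by simp [regular]

theorem NonLogarithmicAtInfinity.holomorphicAt_inv (hH : H.IsAdmissible)
    (h : H.NonLogarithmicAtInfinity) : H.inv.HolomorphicAt 0 := by
  obtain ⟨R, hR, u, hu, h1, hs⟩ := h.2 H.α (by simp)
  refine ⟨R⁻¹, inv_pos.2 hR, u, hu, h1, isSolutionOn_of_locally fun w hw => ?_⟩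
  have hw0 : w ≠ 0 := fun h => zero_notMem_regular (h ▸ hw.2)
  have hz : w⁻¹ ∈ {z : ℂ | R < ‖z‖} ∩ H.regular := by
    refine ⟨?_, inv_mem_regular_inv.1 (by rw [inv_inv]; exact hw.2)⟩
    have h2 : ‖w‖ < R⁻¹ := by simpa [sing] using hw.1
    simpa using (lt_inv_comm₀ (norm_pos_iff.2 hw0) hR).1 h2
  obtain ⟨U, hUW, hU, hzU, L, hL⟩ := exists_open_isLogBranch 0
    ((isOpen_lt continuous_const continuous_norm).inter H.isOpen_regular) hz (inv_ne_zero hw0)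
  have hUr : U ⊆ H.regular := hUW.trans Set.inter_subset_right
  have hV := isOpen_preimage_inv hU fun h => zero_notMem_regular (hUr h)
  refine ⟨_, hV, hzU, (isSolutionOn_inv hH hU hUr hL hV (hu.mono fun v hv => ?_)).1
    (hs U L hU hUW hL)⟩
  have h2 : R < ‖v‖⁻¹ := by simpa using (hUW hv).1
  simpa using (lt_inv_comm₀ hR (inv_pos.1 (hR.trans h2))).1 h2

theorem nonLogarithmicAtInfinity_of_holomorphicAt (hH : H.IsAdmissible) (hne : H.α ≠ H.β)
    (hα : H.inv.HolomorphicAt 0) (hβ : H.swap.inv.HolomorphicAt 0) :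
    H.NonLogarithmicAtInfinity := by
  -- Inversion only treats the exponent `α`; stating this for arbitrary `G` lets `swap` supply the
  -- exponent `β`.
  have key : ∀ G : Heun, G.IsAdmissible → G.inv.HolomorphicAt 0 → ∃ R > (0 : ℝ), ∃ u : ℂ → ℂ,
      DifferentiableOn ℂ u (Metric.ball 0 R⁻¹) ∧ u 0 = 1 ∧
      ∀ (U : Set ℂ) (L : ℂ → ℂ), IsOpen U → U ⊆ {z | R < ‖z‖} ∩ G.regular → IsLogBranch 0 L U →
        G.IsSolutionOn (fun z => Complex.exp (-(G.α * L z)) * u z⁻¹) U := by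
    rintro G hG ⟨r, hr, u, hu, h1, hs⟩
    refine ⟨r⁻¹, inv_pos.2 hr, u, by rw [inv_inv]; exact hu, h1, fun U L hU hUW hL => ?_⟩
    have hUr : U ⊆ G.regular := hUW.trans Set.inter_subset_right
    have hsub : (Inv.inv ⁻¹' U : Set ℂ) ⊆ Metric.ball (G.inv.sing 0) r ∩ G.inv.regular := by
      intro w hw
      have hw2 : r⁻¹ < ‖w‖⁻¹ := by simpa using (hUW hw).1
      have hwp : 0 < ‖w‖ := inv_pos.1 ((inv_pos.2 hr).trans hw2)
      refine ⟨by simpa [sing] using (inv_lt_inv₀ hr hwp).1 hw2, ?_⟩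
      have := inv_mem_regular_inv.2 (hUr hw)
      rwa [inv_inv] at this
    have hV := isOpen_preimage_inv hU fun h => zero_notMem_regular (hUr h)
    exact (isSolutionOn_inv hG hU hUr hL hV (hu.mono (hsub.trans Set.inter_subset_left))).2
      (hs.mono hsub)
  refine ⟨hne, fun ρ hρ => ?_⟩
  rcases hρ with rfl | rfl
  · exact key H hH hα
  · have := key H.swap hH.swap hβ
    simp only [isSolutionOn_swap] at this
    exact this

end Heun

/-! ### Transfer at a finite singularity -/

namespace Heun

/-- `EulerRelated η H' H` in the case `η = H.α` with the exponents of `H'` at infinity in the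
standard order. -/
structure EulerNormal (H' H : Heun) : Prop where
  t : H'.t = H.t
  α : H'.α = 2 - H.α
  β : H'.β = H.β - H.α + 1
  ε : ∀ i, H'.ε i = H.ε i - H.α + 1
  q : H'.q = H.q + (1 - H.α) * (H.ε 2 + H.ε 1 * H.t + (H.ε 0 - H.α) * (H.t + 1))

variable {H H' : Heun} {a b c : Fin 3} {m : ℕ}

theorem EulerNormal.isAdmissible (hE : EulerNormal H' H) (hH : H.IsAdmissible) :
    H'.IsAdmissible := by
  refine ⟨hE.t ▸ hH.1, hE.t ▸ hH.2.1, ?_⟩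
  rw [hE.ε, hE.ε, hE.ε, hE.α, hE.β]
  linear_combination hH.2.2

theorem EulerNormal.sing (hE : EulerNormal H' H) : H'.sing = H.sing := by
  simp [Heun.sing, hE.t]

/-- The relation between `q'` and `q`, rewritten relative to `sing a`, takes the same form at all
three singularities. It is what makes the diagonals of the compared blocks agree. -/
theorem EulerNormal.accessory (hE : EulerNormal H' H) (hH : H.IsAdmissible) (hab : a ≠ b)
    (hbc : b ≠ c) (hca : c ≠ a) : H'.accessory a = H.accessory a + (1 - H.α) *
      (H.ε c * (H.sing b - H.sing a) + H.ε b * (H.sing c - H.sing a)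
        + (H.ε a - H.α) * (H.sing b - H.sing a + (H.sing c - H.sing a))) := by
  have hβ : H.β = H.ε 0 + H.ε 1 + H.ε 2 - H.α - 1 := by linear_combination -hH.2.2
  fin_cases a <;> fin_cases b <;> fin_cases c <;>
    first
    | exact absurd rfl hab
    | exact absurd rfl hbc
    | exact absurd rfl hca
    | (simp [Heun.accessory, Heun.sing, hE.q, hE.α, hE.β, hE.t, hβ, -mul_eq_mul_left_iff]
       try ring)

@[simp] theorem α_gauge (H : Heun) (i : Fin 3) : (H.gauge i).α = H.α + 1 - H.ε i := rfl

@[simp] theorem β_gauge (H : Heun) (i : Fin 3) : (H.gauge i).β = H.β + 1 - H.ε i := rfl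

theorem natCast_sub_natCast_ne_zero {n m : ℕ} (h : n < m) : (n : ℂ) - m ≠ 0 :=
  sub_ne_zero.2 fun heq => h.ne (by exact_mod_cast heq)

/-- The kernels of the blocks of `H'` and `H` at `sing a` with the exponents `1 - ε a`. -/
theorem EulerNormal.blockKernel_gauge (hE : EulerNormal H' H) (hH : H.IsAdmissible) (hab : a ≠ b)
    (hbc : b ≠ c) (hca : c ≠ a) (h₁ : ∀ n < m, (n : ℂ) + 2 - H'.ε a ≠ 0)
    (h₂ : ∀ n < m, (n : ℂ) + 2 - H.ε a ≠ 0) {e' : ℕ → ℂ}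
    (he : BlockKernel ((H'.gauge a).up a b c) ((H'.gauge a).mid a b c) (H'.gauge a).low m e') :
    ∃ e, BlockKernel ((H.gauge a).up a b c) ((H.gauge a).mid a b c) (H.gauge a).low m e ∧
      ∀ n ≤ m, e n = 0 ↔ e' n = 0 := by
  have hβ : H.β = H.ε a + H.ε b + H.ε c - H.α - 1 := by linear_combination -sum_ε hH hab hbc hca
  -- In the gauged equations the source has `n + 2 - H'.ε a` in `up` and `n + 2 - H.ε a` in `low`,
  -- while the target has these factors the other way round. Their quotient is the scaling factor.
  refine BlockKernel.rescale (σ := 1) (κ := fun n => (n + 2 - H'.ε a) / (n + 2 - H.ε a))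
    one_ne_zero (fun n hn => div_ne_zero (h₁ n hn) (h₂ n hn)) (fun n _ => ?_) (fun n hn => ?_)
    (fun n hn => ?_) he
  · simp only [mid, sing_gauge, ε_gauge_self, ε_gauge_of_ne _ hab.symm, ε_gauge_of_ne _ hca,
      accessory_gauge_self hH hab hbc hca,
      accessory_gauge_self (hE.isAdmissible hH) hab hbc hca, hE.accessory hH hab hbc hca,
      hE.sing, hE.ε]
    ring
  · have := h₂ n hn
    simp only [up, sing_gauge, ε_gauge_self, hE.sing]
    field_simp
    ring
  · have := h₂ n hn
    simp only [low, α_gauge, β_gauge, hE.α, hE.β, hE.ε]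
    field_simp
    ring

/-- The gauged source has parameter `-m` at `a`, which closes its block on the side of `up`. The
gauged target has `-m` as first parameter at infinity, which closes the same block on the side of
`low`. If `β'` is not an integer, the second exponent cannot produce another degree. -/
theorem EulerNormal.exists_isPolySolution_gauge (hE : EulerNormal H' H) (hH : H.IsAdmissible)
    (hab : a ≠ b) (hbc : b ≠ c) (hca : c ≠ a) (hε : H'.ε a = m + 2) (hα : NotInt H.α)
    (h : H'.NonLogarithmicAt a) :
    ∃ p : Polynomial ℂ, p ≠ 0 ∧ (H.gauge a).IsPolySolution p ∧ p.natDegree ≤ m ∧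
      (NotInt H'.β → p.natDegree = m) := by
  have hH' := hE.isAdmissible hH
  have hεa : H.ε a = m + 1 + H.α := by linear_combination hε - hE.ε a
  obtain ⟨e', he', he0'⟩ := (h.holomorphicAt_gauge hH').exists_blockKernel (hH'.gauge a) hab hbc hca
    (m := m) (by rw [ε_gauge_self, hε]; ring)
  obtain ⟨e, he, h0⟩ := hE.blockKernel_gauge hH hab hbc hca
    (fun n hn => by
      have := natCast_sub_natCast_ne_zero hn
      rw [hε]; intro h; exact this (by linear_combination h))
    (fun n _ h => hα (n + 1 - m) (by rw [hεa] at h; push_cast; linear_combination -h)) he'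
  obtain ⟨p, hp0, hp, hd⟩ := exists_isPolySolution_of_blockKernel (hH.gauge a) hab hbc hca
    (by simp only [low, α_gauge, hεa]; ring) he (k := 0) (fun h => he0' ((h0 0 (Nat.zero_le _)).1 h))
  refine ⟨p, hp0, hp, hd, fun hβ => ?_⟩
  have hl := hp.low_natDegree (hH.gauge a) hp0
  rcases mul_eq_zero.1 hl with hl | hl
  · have : (p.natDegree : ℂ) = m := by
      rw [α_gauge, hεa] at hl; linear_combination hl
    exact_mod_cast this
  · refine absurd ?_ (hβ (m + 1 - p.natDegree))
    rw [β_gauge, hεa] at hl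
    rw [hE.β]; push_cast; linear_combination hl

/-- The target, gauged at `b` and `c`, has `-m` as its second parameter at infinity. Here the blocks
match in reversed order, so the constant term of the local solution becomes the coefficient of index
`m` of the polynomial. -/
theorem EulerNormal.exists_isPolySolution_gauge_gauge (hE : EulerNormal H' H) (hH : H.IsAdmissible)
    (hab : a ≠ b) (hbc : b ≠ c) (hca : c ≠ a) (hε : H'.ε a = -m)
    (hβ' : NotInt H'.β) (h : H'.NonLogarithmicAt a) :
    ∃ p : Polynomial ℂ, p ≠ 0 ∧ ((H.gauge b).gauge c).IsPolySolution p ∧ p.natDegree = m := by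
  have hH' := hE.isAdmissible hH
  have hεa : H.ε a = H.α - 1 - m := by linear_combination hε - hE.ε a
  have hεc : H.ε c = H.β + 2 + m - H.ε b := by
    linear_combination sum_ε hH hab hbc hca - hεa
  have hA : H.sing b - H.sing a ≠ 0 := sub_ne_zero.2 fun h => hab (sing_injective hH h).symm
  have hB : H.sing c - H.sing a ≠ 0 := sub_ne_zero.2 fun h => hca (sing_injective hH h)
  have hHg := (hH.gauge b).gauge c
  have hdiv : ∀ n : ℕ, (n : ℂ) + 1 + H.β - H.α ≠ 0 := fun n h =>
    hβ' (-n) (by rw [hE.β]; push_cast; linear_combination h)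
  obtain ⟨e', he', he0'⟩ := h.holomorphicAt.exists_blockKernel hH' hab hbc hca hε
  -- The scaling factor is the quotient of the source's `up n` and the target's `low (m - 1 - n)`,
  -- whose common factor `n + 1` cancels; its denominator is `n + β'`.
  obtain ⟨e, he, h0⟩ := BlockKernel.rescale_reverse (u := ((H.gauge b).gauge c).up a b c)
    (d := ((H.gauge b).gauge c).mid a b c) (l := ((H.gauge b).gauge c).low) (σ := 1)
    (κ := fun n => (H.sing b - H.sing a) * (H.sing c - H.sing a) * (n - m) / (n + 1 + H.β - H.α))
    one_ne_zero
    (fun n hn => div_ne_zero (mul_ne_zero (mul_ne_zero hA hB) (natCast_sub_natCast_ne_zero hn))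
      (hdiv n))
    (fun n hn => by
      simp only [mid, sing_gauge, ε_gauge_self, ε_gauge_of_ne _ hca.symm, ε_gauge_of_ne _ hab,
        ε_gauge_of_ne _ hbc, ε_gauge_of_ne _ hbc.symm,
        accessory_gauge_of_ne (hH.gauge b) hca.symm hbc.symm hab.symm,
        accessory_gauge_of_ne hH hab hbc hca, hE.accessory hH hab hbc hca, hE.sing, hE.ε, hεa, hεc,
        Nat.cast_sub hn]
      ring)
    (fun n hn => by
      have := hdiv n
      have e1 : ((m - 1 - n : ℕ) : ℂ) = m - 1 - n := by
        rw [Nat.cast_sub (by omega), Nat.cast_sub (by omega), Nat.cast_one]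
      simp only [up, low, α_gauge, β_gauge, ε_gauge_of_ne _ hbc.symm, hE.sing, hE.ε, hεa, hεc, e1]
      field_simp
      ring)
    (fun n hn => by
      have := hdiv n
      have e1 : ((m - 1 - n : ℕ) : ℂ) = m - 1 - n := by
        rw [Nat.cast_sub (by omega), Nat.cast_sub (by omega), Nat.cast_one]
      simp only [up, low, sing_gauge, ε_gauge_of_ne _ hca.symm, ε_gauge_of_ne _ hab, hE.α, hE.β,
        hεa, e1]
      field_simp
      ring) he'
  obtain ⟨p, hp0, hp, hd⟩ := exists_isPolySolution_of_blockKernel hHg hab hbc hca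
    (by simp only [low, α_gauge, β_gauge, ε_gauge_of_ne _ hbc.symm, hεc]; ring) he (k := m)
    (fun h => he0' (by simpa using (h0 m le_rfl).1 h))
  refine ⟨p, hp0, hp, ?_⟩
  have hl := hp.low_natDegree hHg hp0
  simp only [low, α_gauge, β_gauge, ε_gauge_of_ne _ hbc.symm, hεc] at hl
  rcases mul_eq_zero.1 hl with hl | hl
  · refine absurd ?_ (hβ' (p.natDegree + 1 - m))
    rw [hE.β]; push_cast; linear_combination -hl
  · have : (p.natDegree : ℂ) = m := by linear_combination hl
    exact_mod_cast this

/-- Since `ε a ≥ 2`, the exponent `0` is never obstructed; only `1 - ε a` needs the block, whose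
kernel comes from the given polynomial, necessarily of degree `m`. -/
theorem EulerNormal.nonLogarithmicAt_of_gauge (hE : EulerNormal H' H) (hH : H.IsAdmissible)
    (hab : a ≠ b) (hbc : b ≠ c) (hca : c ≠ a) (hε : H.ε a = m + 2) (hα : NotInt H.α)
    (hβ : NotInt H.β) {p : Polynomial ℂ} (hp0 : p ≠ 0) (hp : (H'.gauge a).IsPolySolution p) :
    H.NonLogarithmicAt a := by
  have hH' := hE.isAdmissible hH
  have hεa : H'.ε a = m + 3 - H.α := by linear_combination hε + hE.ε a
  obtain ⟨e', he', he0', -⟩ := hp.exists_blockKernel (hH'.gauge a) hab hbc hca hp0 (m := m)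
    (fun d hd => by
      simp only [low, α_gauge, β_gauge, hE.α, hE.β, hεa] at hd
      rcases mul_eq_zero.1 hd with hd | hd
      · have : (d : ℂ) = m := by linear_combination hd
        exact_mod_cast this
      · refine absurd ?_ (hβ (m + 1 - d))
        push_cast; linear_combination hd)
    (fun n h => hα (m + 1 - n) (by
      rw [ε_gauge_self, hεa] at h; push_cast; linear_combination h))
  obtain ⟨e, he, h0⟩ := hE.blockKernel_gauge hH hab hbc hca
    (fun n _ h => hα (m + 1 - n) (by rw [hεa] at h; push_cast; linear_combination h))
    (fun n hn => by
      have := natCast_sub_natCast_ne_zero hn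
      rw [hε]; intro h; exact this (by linear_combination h)) he'
  refine nonLogarithmicAt_of_holomorphicAt hH (fun h => ?_)
    (holomorphicAt_of_nonresonant hH a fun n h => ?_)
    (holomorphicAt_of_blockKernel (hH.gauge a) hab hbc hca (m := m)
      (by rw [ε_gauge_self, hε]; ring) he fun h => he0' ((h0 0 (Nat.zero_le _)).1 h))
  · rw [hε] at h
    have : m + 2 = 1 := by exact_mod_cast h
    omega
  · rw [hε] at h
    have : n + (m + 2) = 0 := by exact_mod_cast h
    omega

/-- Now `0` is the obstructed exponent and `1 - ε a` is free. The blocks match in reversed order, so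
the leading coefficient of the polynomial becomes the constant term of the local solution. -/
theorem EulerNormal.nonLogarithmicAt_of_gauge_gauge (hE : EulerNormal H' H) (hH : H.IsAdmissible)
    (hab : a ≠ b) (hbc : b ≠ c) (hca : c ≠ a) (hε : H.ε a = -m) (hα : NotInt H.α)
    (hβ : NotInt H.β) {p : Polynomial ℂ} (hp0 : p ≠ 0)
    (hp : ((H'.gauge b).gauge c).IsPolySolution p) : H.NonLogarithmicAt a := by
  have hH' := hE.isAdmissible hH
  have hεa : H'.ε a = 1 - m - H.α := by linear_combination hε + hE.ε a
  have hεc : H.ε c = H.α + H.β + 1 + m - H.ε b := by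
    linear_combination sum_ε hH hab hbc hca - hε
  have hA : H.sing b - H.sing a ≠ 0 := sub_ne_zero.2 fun h => hab (sing_injective hH h).symm
  have hB : H.sing c - H.sing a ≠ 0 := sub_ne_zero.2 fun h => hca (sing_injective hH h)
  have hHg := (hH'.gauge b).gauge c
  have hdiv : ∀ n : ℕ, (n : ℂ) + 1 - m - H.β ≠ 0 := fun n h =>
    hβ (n + 1 - m) (by push_cast; linear_combination -h)
  obtain ⟨e', he', he0', hem'⟩ := hp.exists_blockKernel hHg hab hbc hca hp0 (m := m)
    (fun d hd => by
      simp only [low, α_gauge, β_gauge, ε_gauge_of_ne _ hbc.symm, hE.α, hE.β, hE.ε, hεc] at hd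
      rcases mul_eq_zero.1 hd with hd | hd
      · refine absurd ?_ (hβ (d + 1 - m))
        push_cast; linear_combination -hd
      · have : (d : ℂ) = m := by linear_combination hd
        exact_mod_cast this)
    (fun n h => hα (n + 1 - m) (by
      rw [ε_gauge_of_ne _ hca.symm, ε_gauge_of_ne _ hab, hεa] at h
      push_cast; linear_combination -h))
  -- The factor `n + 1 - m - α` is common to the source's `up n` and the target's `low (m - 1 - n)`,
  -- and cancels from the scaling factor.
  obtain ⟨e, he, h0⟩ := BlockKernel.rescale_reverse (u := H.up a b c)
    (d := H.mid a b c) (l := H.low) (σ := 1)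
    (κ := fun n => (H.sing b - H.sing a) * (H.sing c - H.sing a) * (n + 1) / (n + 1 - m - H.β))
    one_ne_zero
    (fun n _ => div_ne_zero (mul_ne_zero (mul_ne_zero hA hB) (Nat.cast_add_one_ne_zero n))
      (hdiv n))
    (fun n hn => by
      simp only [mid, sing_gauge, ε_gauge_self, ε_gauge_of_ne _ hca.symm, ε_gauge_of_ne _ hab,
        ε_gauge_of_ne _ hbc, ε_gauge_of_ne _ hbc.symm,
        accessory_gauge_of_ne (hH'.gauge b) hca.symm hbc.symm hab.symm,
        accessory_gauge_of_ne hH' hab hbc hca, hE.accessory hH hab hbc hca, hE.sing, hE.ε, hε, hεc,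
        Nat.cast_sub hn]
      ring)
    (fun n hn => by
      have := hdiv n
      have e1 : ((m - 1 - n : ℕ) : ℂ) = m - 1 - n := by
        rw [Nat.cast_sub (by omega), Nat.cast_sub (by omega), Nat.cast_one]
      simp only [up, low, sing_gauge, ε_gauge_of_ne _ hca.symm, ε_gauge_of_ne _ hab, hE.sing,
        hεa, e1]
      field_simp
      ring)
    (fun n hn => by
      have := hdiv n
      have e1 : ((m - 1 - n : ℕ) : ℂ) = m - 1 - n := by
        rw [Nat.cast_sub (by omega), Nat.cast_sub (by omega), Nat.cast_one]
      simp only [up, low, α_gauge, β_gauge, ε_gauge_of_ne _ hbc.symm, hE.α, hE.β, hE.ε, hε, hεc,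
        e1]
      field_simp
      ring) he'
  refine nonLogarithmicAt_of_holomorphicAt hH (fun h => ?_)
    (holomorphicAt_of_blockKernel hH hab hbc hca hε he fun h =>
      hem' (by simpa using (h0 0 (Nat.zero_le _)).1 h))
    (holomorphicAt_of_nonresonant (hH.gauge a) a fun n h => ?_)
  · rw [hε] at h
    have : 1 + m = 0 := by exact_mod_cast (by linear_combination -h : (1 : ℂ) + m = 0)
    omega
  · rw [ε_gauge_self, hε] at h
    have : n + 2 + m = 0 := by exact_mod_cast (by linear_combination h : (n : ℂ) + 2 + m = 0)
    omega

end Heun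

/-! ### Transfer at infinity -/

namespace Heun

variable {H H' : Heun} {m : ℕ}

theorem IsAdmissible.fullGauge (hH : H.IsAdmissible) : H.fullGauge.IsAdmissible :=
  ((hH.gauge 0).gauge 1).gauge 2

theorem α_fullGauge (hH : H.IsAdmissible) : H.fullGauge.α = 2 - H.β := by
  simp [Heun.fullGauge, gauge]
  linear_combination -hH.2.2

theorem β_fullGauge (hH : H.IsAdmissible) : H.fullGauge.β = 2 - H.α := by
  simp [Heun.fullGauge, gauge]
  linear_combination -hH.2.2

theorem ε_fullGauge (H : Heun) (i : Fin 3) : H.fullGauge.ε i = 2 - H.ε i := by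
  fin_cases i <;> simp [Heun.fullGauge, gauge]

theorem t_fullGauge (H : Heun) : H.fullGauge.t = H.t := rfl

theorem q_fullGauge (H : Heun) : H.fullGauge.q = H.q
    + (1 - H.ε 0) * (H.ε 1 * H.t + H.ε 2) + (2 - H.ε 0) * ((1 - H.ε 1) * H.t + (1 - H.ε 2)) := by
  simp [Heun.fullGauge, gauge]
  ring

theorem accessory_zero (H : Heun) : H.accessory 0 = H.q := by simp [accessory, sing]

theorem natCast_sub_one_sub {n m : ℕ} (h : n < m) : ((m - 1 - n : ℕ) : ℂ) = m - 1 - n := by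
  rw [Nat.cast_sub (by omega), Nat.cast_sub (by omega), Nat.cast_one]

/-- As `α' - β' = m + 1`, the obstructed exponent of the source at infinity is `β'`; `swap` puts it
first before inverting. Inversion also reverses the block and scales it by `1 / t`. -/
theorem EulerNormal.exists_isPolySolution (hE : EulerNormal H' H) (hH : H.IsAdmissible)
    (hβ : H.β = -m) (hα : NotInt H.α) (h : H'.NonLogarithmicAtInfinity) :
    ∃ p : Polynomial ℂ, p ≠ 0 ∧ H.IsPolySolution p ∧ p.natDegree = m := by
  have hH' := hE.isAdmissible hH
  have ht := hH.1
  have hε : H.ε 2 = H.α - m + 1 - H.ε 0 - H.ε 1 := by linear_combination hH.2.2 + hβ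
  have h01 : (0 : Fin 3) ≠ 1 := by decide
  have h12 : (1 : Fin 3) ≠ 2 := by decide
  have h20 : (2 : Fin 3) ≠ 0 := by decide
  have hdiv : ∀ n : ℕ, (n : ℂ) + 1 - m - H.α ≠ 0 := fun n h =>
    hα (n + 1 - m) (by push_cast; linear_combination -h)
  obtain ⟨e', he', he0'⟩ := ((nonLogarithmicAtInfinity_swap.2 h).holomorphicAt_inv
    hH'.swap).exists_blockKernel hH'.swap.inv h01 h12 h20 (m := m) (by
      simp [inv, swap, hE.α, hE.β, hβ]; ring)
  obtain ⟨e, he, h0⟩ := BlockKernel.rescale_reverse (u := H.up 0 1 2) (d := H.mid 0 1 2)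
    (l := H.low) (σ := H.t⁻¹) (κ := fun n => (n - m) / (n + 1 - m - H.α)) (inv_ne_zero ht)
    (fun n hn => div_ne_zero (natCast_sub_natCast_ne_zero hn) (hdiv n))
    (fun n hn => by
      simp only [mid, accessory_zero, inv, swap, Heun.sing, Matrix.cons_val_zero,
        Matrix.cons_val_one, Matrix.cons_val, hE.α, hE.β, hE.ε, hE.t, hE.q, hβ, hε, Nat.cast_sub hn]
      field_simp
      ring)
    (fun n hn => by
      have := hdiv n
      simp only [up, low, inv, swap, Heun.sing, Matrix.cons_val_zero,
        Matrix.cons_val_one, Matrix.cons_val, hE.α, hE.β, hE.t, hβ, natCast_sub_one_sub hn]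
      field_simp
      ring)
    (fun n hn => by
      have := hdiv n
      simp only [up, low, inv, swap, Heun.sing, Matrix.cons_val_zero,
        Matrix.cons_val_one, Matrix.cons_val, hE.β, hE.ε, hβ, natCast_sub_one_sub hn]
      field_simp
      ring) he'
  obtain ⟨p, hp0, hp, hd⟩ := exists_isPolySolution_of_blockKernel hH h01 h12 h20
    (by simp [low, hβ]) he (k := m) (fun h => he0' (by simpa using (h0 m le_rfl).1 h))
  refine ⟨p, hp0, hp, ?_⟩
  rcases mul_eq_zero.1 (hp.low_natDegree hH hp0) with hl | hl
  · refine absurd ?_ (hα (-p.natDegree))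
    push_cast; linear_combination hl
  · have : (p.natDegree : ℂ) = m := by linear_combination hl - hβ
    exact_mod_cast this

/-- Here `β' - α' = m + 1`, so `α'` is the obstructed exponent. The target with all three finite
singularities gauged has `-m` as first parameter at infinity, and its block at `0` matches in the
same order. -/
theorem EulerNormal.exists_isPolySolution_fullGauge (hE : EulerNormal H' H) (hH : H.IsAdmissible)
    (hβ : H.β = m + 2) (hα : NotInt H.α) (hε₀ : NotInt (H.ε 0))
    (h : H'.NonLogarithmicAtInfinity) :
    ∃ p : Polynomial ℂ, p ≠ 0 ∧ H.fullGauge.IsPolySolution p ∧ p.natDegree = m := by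
  have hH' := hE.isAdmissible hH
  have ht := hH.1
  have hε : H.ε 2 = H.α + m + 3 - H.ε 0 - H.ε 1 := by linear_combination hH.2.2 + hβ
  have h01 : (0 : Fin 3) ≠ 1 := by decide
  have h12 : (1 : Fin 3) ≠ 2 := by decide
  have h20 : (2 : Fin 3) ≠ 0 := by decide
  have hdiv : ∀ n : ℕ, (n : ℂ) + 2 - H.ε 0 ≠ 0 := fun n h =>
    hε₀ (n + 2) (by push_cast; linear_combination -h)
  obtain ⟨e', he', he0'⟩ := (h.holomorphicAt_inv hH').exists_blockKernel hH'.inv h01 h12 h20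
    (m := m) (by simp [inv, hE.α, hE.β, hβ]; ring)
  obtain ⟨e, he, h0⟩ := BlockKernel.rescale (u := H.fullGauge.up 0 1 2)
    (d := H.fullGauge.mid 0 1 2) (l := H.fullGauge.low) (σ := H.t⁻¹)
    (κ := fun n => (n - m) / (H.t * (n + 2 - H.ε 0))) (inv_ne_zero ht)
    (fun n hn => div_ne_zero (natCast_sub_natCast_ne_zero hn) (mul_ne_zero ht (hdiv n)))
    (fun n hn => by
      simp only [mid, q_fullGauge, accessory_zero, ε_fullGauge, t_fullGauge, inv,
        Heun.sing, Matrix.cons_val_zero, Matrix.cons_val_one, Matrix.cons_val, hE.α, hE.β, hE.ε,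
        hE.t, hE.q, hβ, hε]
      field_simp
      ring)
    (fun n hn => by
      have := hdiv n
      simp only [up, ε_fullGauge, t_fullGauge, inv, Heun.sing, Matrix.cons_val_zero,
        Matrix.cons_val_one, Matrix.cons_val, hE.α, hE.β, hE.t, hβ]
      field_simp
      ring)
    (fun n hn => by
      have := hdiv n
      simp only [low, α_fullGauge hH, β_fullGauge hH, inv, hE.α, hE.ε, hβ]
      field_simp
      ring) he'
  obtain ⟨p, hp0, hp, hd⟩ := exists_isPolySolution_of_blockKernel hH.fullGauge h01 h12 h20
    (by simp [low, α_fullGauge hH, hβ]) he (k := 0)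
    (fun h => he0' ((h0 0 (Nat.zero_le _)).1 h))
  refine ⟨p, hp0, hp, ?_⟩
  have hl := hp.low_natDegree hH.fullGauge hp0
  rw [low, α_fullGauge hH, β_fullGauge hH] at hl
  rcases mul_eq_zero.1 hl with hl | hl
  · have : (p.natDegree : ℂ) = m := by linear_combination hl + hβ
    exact_mod_cast this
  · refine absurd ?_ (hα (p.natDegree + 2))
    push_cast; linear_combination -hl

/-- As `β' = -m`, the polynomial has degree `m`. Of the exponents of the target at infinity only `β
= α - m - 1` can be obstructed; its block is that of the polynomial reversed. -/
theorem EulerNormal.nonLogarithmicAtInfinity_of_isPolySolution (hE : EulerNormal H' H)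
    (hH : H.IsAdmissible) (hβ : H.β = H.α - m - 1) (hα : NotInt H.α) (hε₀ : NotInt (H'.ε 0))
    {p : Polynomial ℂ} (hp0 : p ≠ 0) (hp : H'.IsPolySolution p) : H.NonLogarithmicAtInfinity := by
  have hH' := hE.isAdmissible hH
  have ht := hH.1
  have hε : H.ε 2 = 2 * H.α - m - H.ε 0 - H.ε 1 := by linear_combination hH.2.2 + hβ
  have h01 : (0 : Fin 3) ≠ 1 := by decide
  have h12 : (1 : Fin 3) ≠ 2 := by decide
  have h20 : (2 : Fin 3) ≠ 0 := by decide
  have hdiv : ∀ n : ℕ, (n : ℂ) + 2 - H.α ≠ 0 := fun n h =>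
    hα (n + 2) (by push_cast; linear_combination -h)
  obtain ⟨e', he', he0', hem'⟩ := hp.exists_blockKernel hH' h01 h12 h20 hp0 (m := m)
    (fun d hd => by
      rw [low, hE.α, hE.β, hβ] at hd
      rcases mul_eq_zero.1 hd with hd | hd
      · exact absurd (by linear_combination hd) (hdiv d)
      · have : (d : ℂ) = m := by linear_combination hd
        exact_mod_cast this)
    (fun n h => hε₀ (-n) (by push_cast; linear_combination h))
  obtain ⟨e, he, h0⟩ := BlockKernel.rescale_reverse (u := H.swap.inv.up 0 1 2)
    (d := H.swap.inv.mid 0 1 2) (l := H.swap.inv.low) (σ := H.t)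
    (κ := fun n => (n + 1) / (n + 2 - H.α)) ht
    (fun n hn => div_ne_zero (Nat.cast_add_one_ne_zero n) (hdiv n))
    (fun n hn => by
      simp only [mid, accessory_zero, inv, swap, Heun.sing, Matrix.cons_val_zero,
        Matrix.cons_val_one, Matrix.cons_val, hE.ε, hE.t, hE.q, hβ, hε, Nat.cast_sub hn]
      field_simp
      ring)
    (fun n hn => by
      have := hdiv n
      simp only [up, low, inv, swap, Heun.sing, Matrix.cons_val_zero,
        Matrix.cons_val_one, Matrix.cons_val, hE.ε, hE.t, hβ, natCast_sub_one_sub hn]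
      field_simp
      ring)
    (fun n hn => by
      have := hdiv n
      simp only [up, low, inv, swap, Heun.sing, Matrix.cons_val_zero,
        Matrix.cons_val_one, Matrix.cons_val, hE.α, hE.β, hβ, natCast_sub_one_sub hn]
      field_simp
      ring) he'
  refine nonLogarithmicAtInfinity_of_holomorphicAt hH (fun h => ?_)
    (holomorphicAt_of_nonresonant hH.inv 0 fun n h => ?_)
    (holomorphicAt_of_blockKernel hH.swap.inv h01 h12 h20 (m := m)
      (by simp [inv, swap, hβ]) he
      fun h => hem' (by simpa using (h0 0 (Nat.zero_le _)).1 h))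
  · have : m + 1 = 0 := by
      exact_mod_cast (by linear_combination h + hβ : (m : ℂ) + 1 = 0)
    omega
  · have h' : (n : ℂ) + (1 + H.α - H.β) = 0 := h
    have : n + m + 2 = 0 := by
      exact_mod_cast (by linear_combination h' + hβ : (n : ℂ) + m + 2 = 0)
    omega

/-- Now `α = β - m - 1` is the only exponent that can be obstructed, and the blocks match in the
same order, the constant term of the polynomial giving that of the local solution. -/
theorem EulerNormal.nonLogarithmicAtInfinity_of_fullGauge (hE : EulerNormal H' H)
    (hH : H.IsAdmissible) (hβ : H.β = H.α + m + 1) (hα : NotInt H.α) (hε₀ : NotInt (H'.ε 0))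
    {p : Polynomial ℂ} (hp0 : p ≠ 0) (hp : H'.fullGauge.IsPolySolution p) :
    H.NonLogarithmicAtInfinity := by
  have hH' := hE.isAdmissible hH
  have ht := hH.1
  have hε : H.ε 2 = 2 * H.α + m + 2 - H.ε 0 - H.ε 1 := by linear_combination hH.2.2 + hβ
  have h01 : (0 : Fin 3) ≠ 1 := by decide
  have h12 : (1 : Fin 3) ≠ 2 := by decide
  have h20 : (2 : Fin 3) ≠ 0 := by decide
  have hnum : ∀ n : ℕ, (n : ℂ) + 2 - H'.ε 0 ≠ 0 := fun n h =>
    hε₀ (n + 2) (by push_cast; linear_combination -h)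
  obtain ⟨e', he', he0', -⟩ := hp.exists_blockKernel hH'.fullGauge h01 h12 h20 hp0 (m := m)
    (fun d hd => by
      rw [low, α_fullGauge hH', β_fullGauge hH', hE.α, hE.β, hβ] at hd
      rcases mul_eq_zero.1 hd with hd | hd
      · have : (d : ℂ) = m := by linear_combination hd
        exact_mod_cast this
      · exact absurd (by push_cast; linear_combination hd) (hα (-d)))
    (fun n h => hnum n (by rw [ε_fullGauge] at h; linear_combination h))
  obtain ⟨e, he, h0⟩ := BlockKernel.rescale (u := H.inv.up 0 1 2) (d := H.inv.mid 0 1 2)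
    (l := H.inv.low) (σ := H.t) (κ := fun n => H.t * (n + 2 - H'.ε 0) / (n - m)) ht
    (fun n hn => div_ne_zero (mul_ne_zero ht (hnum n)) (natCast_sub_natCast_ne_zero hn))
    (fun n hn => by
      simp only [mid, q_fullGauge, accessory_zero, ε_fullGauge, t_fullGauge, inv,
        Heun.sing, Matrix.cons_val_zero, Matrix.cons_val_one, Matrix.cons_val, hE.ε,
        hE.t, hE.q, hβ, hε]
      field_simp
      ring)
    (fun n hn => by
      have := natCast_sub_natCast_ne_zero hn
      simp only [up, ε_fullGauge, t_fullGauge, inv, Heun.sing, Matrix.cons_val_zero,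
        Matrix.cons_val_one, Matrix.cons_val, hE.t, hβ]
      field_simp
      ring)
    (fun n hn => by
      have := natCast_sub_natCast_ne_zero hn
      simp only [low, α_fullGauge hH', β_fullGauge hH', inv, hE.α, hE.β, hE.ε, hβ]
      field_simp
      ring) he'
  refine nonLogarithmicAtInfinity_of_holomorphicAt hH (fun h => ?_)
    (holomorphicAt_of_blockKernel hH.inv h01 h12 h20 (m := m) (by simp [inv, hβ]; ring) he
      fun h => he0' ((h0 0 (Nat.zero_le _)).1 h))
    (holomorphicAt_of_nonresonant hH.swap.inv 0 fun n h => ?_)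
  · have : m + 1 = 0 := by
      exact_mod_cast (by linear_combination -h - hβ : (m : ℂ) + 1 = 0)
    omega
  · have h' : (n : ℂ) + (1 + H.β - H.α) = 0 := h
    have : n + m + 2 = 0 := by
      exact_mod_cast (by linear_combination h' - hβ : (n : ℂ) + m + 2 = 0)
    omega

/-! ### Assembly and reduction to the normal case -/

/-- The eight assertions about a pair of equations related by Euler's integral transformation. -/
def EulerTransfer (η : ℂ) (H' H : Heun) (a b c : Fin 3) : Prop :=
    ((∃ n : ℤ, 2 ≤ n ∧ H'.ε a = n) → NotInt η → H'.NonLogarithmicAt a →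
      ∃ h : Polynomial ℂ, h ≠ 0 ∧ H.IsPolyTypeSolution (Pi.single a (1 - H.ε a)) h ∧
        (∀ n : ℤ, H'.ε a = n → (h.natDegree : ℤ) ≤ n - 2) ∧
        (NotInt H'.α → NotInt H'.β → (h.natDegree : ℂ) = H'.ε a - 2)) ∧
    ((∃ n : ℤ, n ≤ 0 ∧ H'.ε a = n) → NotInt η → NotInt H'.α → NotInt H'.β →
      NotInt (H.ε b) → NotInt (H.ε c) → H'.NonLogarithmicAt a →
      ∃ h : Polynomial ℂ, h ≠ 0 ∧
        H.IsPolyTypeSolution (Pi.single b (1 - H.ε b) + Pi.single c (1 - H.ε c)) h ∧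
        (h.natDegree : ℂ) = -H'.ε a) ∧
    ((∃ n : ℤ, 2 ≤ n ∧ H.ε a = n) → NotInt H.α → NotInt H.β →
      (∃ h : Polynomial ℂ, h ≠ 0 ∧ H'.IsPolyTypeSolution (Pi.single a (1 - H'.ε a)) h) →
      H.NonLogarithmicAt a) ∧
    ((∃ n : ℤ, n ≤ 0 ∧ H.ε a = n) → NotInt H.α → NotInt H.β →
      NotInt (H'.ε b) → NotInt (H'.ε c) →
      (∃ h : Polynomial ℂ, h ≠ 0 ∧
        H'.IsPolyTypeSolution (Pi.single b (1 - H'.ε b) + Pi.single c (1 - H'.ε c)) h) →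
      H.NonLogarithmicAt a) ∧
    ((∃ n : ℤ, n ≤ 0 ∧ H.α + H.β - η = n) → NotInt η → H'.NonLogarithmicAtInfinity →
      ∃ h : Polynomial ℂ, h ≠ 0 ∧ H.IsPolyTypeSolution 0 h ∧
        (h.natDegree : ℂ) = η - H.α - H.β) ∧
    ((∃ n : ℤ, 2 ≤ n ∧ H.α + H.β - η = n) → NotInt η → (∀ i, NotInt (H.ε i)) →
      H'.NonLogarithmicAtInfinity →
      ∃ h : Polynomial ℂ, h ≠ 0 ∧ H.IsPolyTypeSolution (fun i => 1 - H.ε i) h ∧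
        (h.natDegree : ℂ) = H.α + H.β - η - 2) ∧
    ((∃ n : ℤ, n ≤ -1 ∧ H.α + H.β - 2 * η = n) → NotInt η → NotInt (H'.ε 0) →
      (∃ h : Polynomial ℂ, h ≠ 0 ∧ H'.IsPolyTypeSolution 0 h) →
      H.NonLogarithmicAtInfinity) ∧
    ((∃ n : ℤ, 1 ≤ n ∧ H.α + H.β - 2 * η = n) → NotInt η → (∀ i, NotInt (H'.ε i)) →
      (∃ h : Polynomial ℂ, h ≠ 0 ∧ H'.IsPolyTypeSolution (fun i => 1 - H'.ε i) h) →
      H.NonLogarithmicAtInfinity)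

theorem EulerNormal.eulerTransfer (hE : EulerNormal H' H) (hH : H.IsAdmissible) {a b c : Fin 3}
    (hab : a ≠ b) (hbc : b ≠ c) (hca : c ≠ a) : EulerTransfer H.α H' H a b c := by
  have hH' := hE.isAdmissible hH
  refine ⟨?_, ?_, ?_, ?_, ?_, ?_, ?_, ?_⟩
  · rintro ⟨n, hn, hε⟩ hη h
    obtain ⟨m, rfl⟩ : ∃ m : ℕ, n = m + 2 := ⟨(n - 2).toNat, by omega⟩
    push_cast at hε
    obtain ⟨p, hp0, hp, hd, hd'⟩ := hE.exists_isPolySolution_gauge hH hab hbc hca hε hη h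
    refine ⟨p, hp0, (isPolyTypeSolution_single hH).2 hp, fun k hk => ?_, fun _ hβ => ?_⟩
    · rw [hε] at hk
      have : (m : ℤ) + 2 = k := by exact_mod_cast hk
      omega
    · rw [hd' hβ, hε]; ring
  · rintro ⟨n, hn, hε⟩ - - hβ' - - h
    obtain ⟨m, rfl⟩ : ∃ m : ℕ, n = -m := ⟨(-n).toNat, by omega⟩
    push_cast at hε
    obtain ⟨p, hp0, hp, hd⟩ := hE.exists_isPolySolution_gauge_gauge hH hab hbc hca hε hβ' h
    exact ⟨p, hp0, (isPolyTypeSolution_pair hH hbc).2 hp, by rw [hd, hε, neg_neg]⟩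
  · rintro ⟨n, hn, hε⟩ hα hβ ⟨p, hp0, hp⟩
    obtain ⟨m, rfl⟩ : ∃ m : ℕ, n = m + 2 := ⟨(n - 2).toNat, by omega⟩
    push_cast at hε
    exact hE.nonLogarithmicAt_of_gauge hH hab hbc hca hε hα hβ hp0
      ((isPolyTypeSolution_single hH').1 hp)
  · rintro ⟨n, hn, hε⟩ hα hβ - - ⟨p, hp0, hp⟩
    obtain ⟨m, rfl⟩ : ∃ m : ℕ, n = -m := ⟨(-n).toNat, by omega⟩
    push_cast at hε
    exact hE.nonLogarithmicAt_of_gauge_gauge hH hab hbc hca hε hα hβ hp0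
      ((isPolyTypeSolution_pair hH' hbc).1 hp)
  · rintro ⟨n, hn, hs⟩ hα h
    obtain ⟨m, rfl⟩ : ∃ m : ℕ, n = -m := ⟨(-n).toNat, by omega⟩
    push_cast at hs
    obtain ⟨p, hp0, hp, hd⟩ := hE.exists_isPolySolution hH (m := m) (by linear_combination hs) hα h
    exact ⟨p, hp0, isPolyTypeSolution_zero.2 hp, by rw [hd]; linear_combination hs⟩
  · rintro ⟨n, hn, hs⟩ hα hε h
    obtain ⟨m, rfl⟩ : ∃ m : ℕ, n = m + 2 := ⟨(n - 2).toNat, by omega⟩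
    push_cast at hs
    obtain ⟨p, hp0, hp, hd⟩ := hE.exists_isPolySolution_fullGauge hH (m := m)
      (by linear_combination hs) hα (hε 0) h
    exact ⟨p, hp0, (isPolyTypeSolution_full hH).2 hp, by rw [hd]; linear_combination -hs⟩
  · rintro ⟨n, hn, hs⟩ hα hε ⟨p, hp0, hp⟩
    obtain ⟨m, rfl⟩ : ∃ m : ℕ, n = -m - 1 := ⟨(-n - 1).toNat, by omega⟩
    push_cast at hs
    exact hE.nonLogarithmicAtInfinity_of_isPolySolution hH (m := m) (by linear_combination hs) hα hε
      hp0 (isPolyTypeSolution_zero.1 hp)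
  · rintro ⟨n, hn, hs⟩ hα hε ⟨p, hp0, hp⟩
    obtain ⟨m, rfl⟩ : ∃ m : ℕ, n = m + 1 := ⟨(n - 1).toNat, by omega⟩
    push_cast at hs
    exact hE.nonLogarithmicAtInfinity_of_fullGauge hH (m := m) (by linear_combination hs) hα (hε 0)
      hp0 ((isPolyTypeSolution_full hH').1 hp)

theorem eulerTransfer_swap_left {η : ℂ} {a b c : Fin 3} (h : EulerTransfer η H'.swap H a b c) :
    EulerTransfer η H' H a b c := by
  simp only [EulerTransfer, isPolyTypeSolution_swap, nonLogarithmicAt_swap,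
    nonLogarithmicAtInfinity_swap] at h ⊢
  obtain ⟨h1, h2, h3⟩ := h
  refine ⟨fun hn hη hl => ?_, fun hn hη hα hβ => h2 hn hη hβ hα, h3⟩
  obtain ⟨p, hp0, hp, hd, hd'⟩ := h1 hn hη hl
  exact ⟨p, hp0, hp, hd, fun hα hβ => hd' hβ hα⟩

theorem eulerTransfer_swap_right {η : ℂ} {a b c : Fin 3} (h : EulerTransfer η H' H.swap a b c) :
    EulerTransfer η H' H a b c := by
  have e : H.swap.α + H.swap.β = H.α + H.β := add_comm _ _
  have e' : η - H.swap.α - H.swap.β = η - H.α - H.β := by linear_combination -e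
  simp only [EulerTransfer, isPolyTypeSolution_swap, nonLogarithmicAt_swap,
    nonLogarithmicAtInfinity_swap, e, e'] at h ⊢
  obtain ⟨h1, h2, h3, h4, h5⟩ := h
  exact ⟨h1, h2, fun hn hα hβ => h3 hn hβ hα, fun hn hα hβ => h4 hn hβ hα, h5⟩

/-- The choice of `η` among `α` and `β` and the order of `α'` and `β'` leave four cases. All
assertions are invariant under exchanging the exponents at infinity of either equation, so each case
reduces to `EulerNormal`. -/
theorem EulerRelated.eulerTransfer {η : ℂ} (hE : EulerRelated η H' H) (hH : H.IsAdmissible)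
    {a b c : Fin 3} (hab : a ≠ b) (hbc : b ≠ c) (hca : c ≠ a) : EulerTransfer η H' H a b c := by
  have key : ∀ G : Heun, G.IsAdmissible → EulerRelated G.α H' G →
      EulerTransfer G.α H' G a b c := by
    rintro G hG ⟨ht, -, hε, hs, hq⟩
    rcases Set.pair_eq_pair_iff.1 hs with ⟨hα, hβ⟩ | ⟨hα, hβ⟩
    · exact EulerNormal.eulerTransfer ⟨ht, hα, by linear_combination hβ, hε, hq⟩ hG hab hbc hca
    · exact eulerTransfer_swap_left (EulerNormal.eulerTransfer (H' := H'.swap)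
        ⟨ht, hβ, by simp only [swap]; linear_combination hα, hε, hq⟩ hG hab hbc hca)
  rcases mul_eq_zero.1 hE.2.1 with h | h
  · obtain rfl := sub_eq_zero.1 h
    exact key H hH hE
  · obtain rfl := sub_eq_zero.1 h
    obtain ⟨ht, -, hε, hs, hq⟩ := hE
    refine eulerTransfer_swap_right (key H.swap hH.swap ⟨ht, by simp [swap], hε, ?_, hq⟩)
    rw [hs]
    simp only [swap, add_comm H.β]

end Heun

theorem mainTheorem1 (η : ℂ) (H' H : Heun) (hH : H.IsAdmissible)
    (hE : Heun.EulerRelated η H' H)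
    (a b c : Fin 3) (hab : a ≠ b) (hbc : b ≠ c) (hca : c ≠ a) :
    ((∃ n : ℤ, 2 ≤ n ∧ H'.ε a = n) → NotInt η → H'.NonLogarithmicAt a →
      ∃ h : Polynomial ℂ, h ≠ 0 ∧ H.IsPolyTypeSolution (Pi.single a (1 - H.ε a)) h ∧
        (∀ n : ℤ, H'.ε a = n → (h.natDegree : ℤ) ≤ n - 2) ∧
        (NotInt H'.α → NotInt H'.β → (h.natDegree : ℂ) = H'.ε a - 2)) ∧
    ((∃ n : ℤ, n ≤ 0 ∧ H'.ε a = n) → NotInt η → NotInt H'.α → NotInt H'.β →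
      NotInt (H.ε b) → NotInt (H.ε c) → H'.NonLogarithmicAt a →
      ∃ h : Polynomial ℂ, h ≠ 0 ∧
        H.IsPolyTypeSolution (Pi.single b (1 - H.ε b) + Pi.single c (1 - H.ε c)) h ∧
        (h.natDegree : ℂ) = -H'.ε a) ∧
    ((∃ n : ℤ, 2 ≤ n ∧ H.ε a = n) → NotInt H.α → NotInt H.β →
      (∃ h : Polynomial ℂ, h ≠ 0 ∧ H'.IsPolyTypeSolution (Pi.single a (1 - H'.ε a)) h) →
      H.NonLogarithmicAt a) ∧
    ((∃ n : ℤ, n ≤ 0 ∧ H.ε a = n) → NotInt H.α → NotInt H.β →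
      NotInt (H'.ε b) → NotInt (H'.ε c) →
      (∃ h : Polynomial ℂ, h ≠ 0 ∧
        H'.IsPolyTypeSolution (Pi.single b (1 - H'.ε b) + Pi.single c (1 - H'.ε c)) h) →
      H.NonLogarithmicAt a) ∧
    ((∃ n : ℤ, n ≤ 0 ∧ H.α + H.β - η = n) → NotInt η → H'.NonLogarithmicAtInfinity →
      ∃ h : Polynomial ℂ, h ≠ 0 ∧ H.IsPolyTypeSolution 0 h ∧
        (h.natDegree : ℂ) = η - H.α - H.β) ∧
    ((∃ n : ℤ, 2 ≤ n ∧ H.α + H.β - η = n) → NotInt η → (∀ i, NotInt (H.ε i)) →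
      H'.NonLogarithmicAtInfinity →
      ∃ h : Polynomial ℂ, h ≠ 0 ∧ H.IsPolyTypeSolution (fun i => 1 - H.ε i) h ∧
        (h.natDegree : ℂ) = H.α + H.β - η - 2) ∧
    ((∃ n : ℤ, n ≤ -1 ∧ H.α + H.β - 2 * η = n) → NotInt η → NotInt (H'.ε 0) →
      (∃ h : Polynomial ℂ, h ≠ 0 ∧ H'.IsPolyTypeSolution 0 h) →
      H.NonLogarithmicAtInfinity) ∧
    ((∃ n : ℤ, 1 ≤ n ∧ H.α + H.β - 2 * η = n) → NotInt η → (∀ i, NotInt (H'.ε i)) →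
      (∃ h : Polynomial ℂ, h ≠ 0 ∧ H'.IsPolyTypeSolution (fun i => 1 - H'.ε i) h) →
      H.NonLogarithmicAtInfinity) := by
  exact hE.eulerTransfer hH hab hbc hca
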